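/- Let $T$ be a first-order theory in the language $\{\in\}$ of set theory that extends $\mathrm{ZF}$ (every axiom of $\mathrm{ZF}$ is a consequence of $T$). An element $a$ of a structure $M$ is called algebraic in $M$ if there is a first-order formula $\varphi(x)$ without parameters such that $M\models\varphi[a]$ and $\{b\in M : M\models\varphi[b]\}$ is finite; $M$ is called (pointwise) algebraic if each of its elements is algebraic in $M$. Let $V=\mathrm{HOD}$ be the sentence of set theory that says that every set is hereditarily ordinal definable; here a set $a$ is ordinal definable if for some ordinal $\theta$ it is an element of $V_\theta$ that is definable in $\langle V_\theta,\in\rangle$ by a first-order formula with ordinal parameters below $\theta$, and $a$ is hereditarily ordinal definable if $a$ and all elements of its transitive closure are ordinal definable. Then $T$ has a pointwise algebraic model if and only if $T$ is consistent with $V=\mathrm{HOD}$, i.e. $T\cup\{V=\mathrm{HOD}\}$ has a model. -/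

import Mathlib

namespace SetTheoryLogic

open FirstOrder FirstOrder.Language

/-! ### The first-order language of set theory -/

/-- The only non-logical symbol is one binary relation symbol, membership. -/
inductive MemRel : ℕ → Type
  | mem : MemRel 2

/-- The language of set theory (equality is a logical symbol). -/
def LSet : FirstOrder.Language.{0, 0} := ⟨fun _ => Empty, MemRel⟩

/-- Formulas of set theory in which the variables `0, …, n - 1` are in scope. A quantifier
binds the variable numbered `n`. -/
abbrev SetFormula (n : ℕ) := LSet.BoundedFormula Empty n

/-- A variable in scope, seen in the scope of one more quantifier. -/
postfix:max "⇡" => Fin.castSucc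

/-- The atomic formula `x ∈ y`. -/
def mem {n : ℕ} (x y : Fin n) : SetFormula n :=
  Relations.boundedFormula₂ (L := LSet) MemRel.mem (Term.var (Sum.inr x)) (Term.var (Sum.inr y))

/-- The atomic formula `x = y`. -/
def eq {n : ℕ} (x y : Fin n) : SetFormula n :=
  Term.bdEqual (Term.var (Sum.inr x)) (Term.var (Sum.inr y))

/-- `all fun z => φ z` is the formula `∀ z, φ z`. -/
def all {n : ℕ} (φ : Fin (n + 1) → SetFormula (n + 1)) : SetFormula n :=
  BoundedFormula.all (φ (Fin.last n))

/-- `ex fun z => φ z` is the formula `∃ z, φ z`. -/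
def ex {n : ℕ} (φ : Fin (n + 1) → SetFormula (n + 1)) : SetFormula n :=
  BoundedFormula.ex (φ (Fin.last n))

/-- `∀ z ∈ x, φ z`. -/
def allIn {n : ℕ} (x : Fin n) (φ : Fin (n + 1) → SetFormula (n + 1)) : SetFormula n :=
  all fun z => mem z x⇡ ⟹ φ z

/-- `∃ z ∈ x, φ z`. -/
def exIn {n : ℕ} (x : Fin n) (φ : Fin (n + 1) → SetFormula (n + 1)) : SetFormula n :=
  ex fun z => mem z x⇡ ⊓ φ z

/-- The formula `φ` with the variable `v i` in the place of its free variable `i`. -/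
def inst {α : Type} {n : ℕ} (φ : LSet.Formula α) (v : α → Fin n) : SetFormula n :=
  BoundedFormula.relabel (fun i => Sum.inr (v i)) φ

/-! ### Basic set-theoretic notions as formulas -/

/-- `x ⊆ y`. -/
def subset {n : ℕ} (x y : Fin n) : SetFormula n :=
  allIn x fun z => mem z y⇡

/-- `x = ∅`. -/
def isEmpty {n : ℕ} (x : Fin n) : SetFormula n :=
  all fun z => ∼(mem z x⇡)

/-- `y = x ∪ {x}`. -/
def isSucc {n : ℕ} (y x : Fin n) : SetFormula n :=
  all fun z => mem z y⇡ ⇔ (mem z x⇡ ⊔ eq z x⇡)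

/-- `p = {x, y}`. -/
def isUnorderedPair {n : ℕ} (p x y : Fin n) : SetFormula n :=
  all fun z => mem z p⇡ ⇔ (eq z x⇡ ⊔ eq z y⇡)

/-- `p = (x, y) = {{x}, {x, y}}`. -/
def isPair {n : ℕ} (p x y : Fin n) : SetFormula n :=
  all fun z => mem z p⇡ ⇔ (isUnorderedPair z x⇡ x⇡ ⊔ isUnorderedPair z x⇡ y⇡)

/-- `(x, y) ∈ f`; for a function `f` this says `f x = y`. -/
def app {n : ℕ} (f x y : Fin n) : SetFormula n :=
  exIn f fun p => isPair p x⇡ y⇡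

/-- `f` is a function with domain `d`. -/
def isFunOn {n : ℕ} (f d : Fin n) : SetFormula n :=
  (allIn f fun p => exIn d⇡ fun x => ex fun y => isPair p⇡⇡ x⇡ y) ⊓
  (allIn d fun x => ex fun y => app f⇡⇡ x⇡ y ⊓ all fun z => app f⇡⇡⇡ x⇡⇡ z ⟹ eq z y⇡)

/-- `f` is a function from `d` to `c`. -/
def isFun {n : ℕ} (f d c : Fin n) : SetFormula n :=
  isFunOn f d ⊓ all fun x => all fun y => app f⇡⇡ x⇡ y ⟹ mem y c⇡⇡

/-- `x` is a transitive set. -/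
def isTransitive {n : ℕ} (x : Fin n) : SetFormula n :=
  allIn x fun y => subset y x⇡

/-- `x` is an ordinal: a transitive set of transitive sets. -/
def isOrdinal {n : ℕ} (x : Fin n) : SetFormula n :=
  isTransitive x ⊓ allIn x fun y => isTransitive y

/-- `x` contains `∅` and is closed under `y ↦ y ∪ {y}`. -/
def isInductive {n : ℕ} (x : Fin n) : SetFormula n :=
  (exIn x fun e => isEmpty e) ⊓ (allIn x fun y => exIn x⇡ fun z => isSucc z y⇡)

/-- `w = ω`, the least inductive set. -/
def isOmega {n : ℕ} (w : Fin n) : SetFormula n :=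
  isInductive w ⊓ all fun x => isInductive x ⟹ subset w⇡ x

/-- `y` is an element of the transitive closure of `x`. -/
def inTransitiveClosure {n : ℕ} (y x : Fin n) : SetFormula n :=
  all fun t => (isTransitive t ⊓ subset x⇡ t) ⟹ mem y⇡ t

/-! ### The axioms of `ZF` -/

/-- Sets with the same elements are equal. -/
def extensionality : LSet.Sentence :=
  all fun x => all fun y => (all fun z => mem z x⇡⇡ ⇔ mem z y⇡) ⟹ eq x⇡ y

/-- Every nonempty set has an `∈`-minimal element. -/
def foundation : LSet.Sentence :=
  all fun x => (ex fun y => mem y x⇡) ⟹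
    exIn x fun y => allIn y fun z => ∼(mem z x⇡⇡)

/-- `{x, y}` exists. -/
def pairing : LSet.Sentence :=
  all fun x => all fun y => ex fun p => isUnorderedPair p x⇡⇡ y⇡

/-- `⋃ x` exists. -/
def union : LSet.Sentence :=
  all fun x => ex fun u => all fun z => mem z u⇡ ⇔ exIn x⇡⇡ fun y => mem z⇡ y

/-- The power set of `x` exists. -/
def powerset : LSet.Sentence :=
  all fun x => ex fun p => all fun z => mem z p⇡ ⇔ subset z x⇡⇡

/-- An inductive set exists. -/
def infinity : LSet.Sentence :=
  ex fun x => isInductive x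

/-- For all parameters and all `a`, the set `{x ∈ a | φ(parameters, x)}` exists. -/
def separation (n : ℕ) (φ : LSet.Formula (Fin n ⊕ Fin 1)) : LSet.Sentence :=
  BoundedFormula.alls (n := n) <|
    all fun a => ex fun b => all fun x =>
      mem x b⇡ ⇔ (mem x a⇡⇡ ⊓ inst φ (Sum.elim (fun i => i⇡⇡⇡) ![x]))

/-- For all parameters and all `a`, if for every `x ∈ a` there is at most one `y` with
`φ(parameters, x, y)`, then the set `{y | ∃ x ∈ a, φ(parameters, x, y)}` exists. -/
def replacement (n : ℕ) (φ : LSet.Formula (Fin n ⊕ Fin 2)) : LSet.Sentence :=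
  BoundedFormula.alls (n := n) <|
    all fun a =>
      (allIn a fun x => all fun y => all fun z =>
        (inst φ (Sum.elim (fun i => i⇡⇡⇡⇡) ![x⇡⇡, y⇡]) ⊓
          inst φ (Sum.elim (fun i => i⇡⇡⇡⇡) ![x⇡⇡, z])) ⟹ eq y⇡ z) ⟹
      ex fun b => all fun y =>
        mem y b⇡ ⇔ exIn a⇡⇡ fun x => inst φ (Sum.elim (fun i => i⇡⇡⇡⇡) ![x, y⇡])

/-- Zermelo–Fraenkel set theory (without choice). -/
def ZF : LSet.Theory :=
  {extensionality, foundation, pairing, union, powerset, infinity} ∪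
    {σ | ∃ n φ, σ = separation n φ} ∪ {σ | ∃ n φ, σ = replacement n φ}

/-! ### Ordinal definability and `V = HOD` -/

/-- `θ` is an ordinal and `A = V_θ`: there is a function `f` on `θ + 1` with
`f β = {x | ∃ γ < β, x ⊆ f γ}` for all `β ≤ θ`, and `f θ = A`. -/
def isV {n : ℕ} (θ A : Fin n) : SetFormula n :=
  isOrdinal θ ⊓ ex fun d => isSucc d θ⇡ ⊓ ex fun f =>
    isFunOn f d⇡ ⊓
    (allIn d⇡ fun β => all fun B => app f⇡⇡ β⇡ B ⟹
      all fun x => mem x B⇡ ⇔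
        exIn β⇡⇡ fun γ => ex fun C => app f⇡⇡⇡⇡⇡ γ⇡ C ⊓ subset x⇡⇡ C) ⊓
    app f θ⇡⇡ A⇡⇡

/-- The assignments (functions on `w`) `s` and `t` agree except perhaps at the index `i`. -/
def agreeOff {n : ℕ} (w s t i : Fin n) : SetFormula n :=
  allIn w fun j => ∼(eq j i⇡) ⟹ all fun y => app s⇡⇡ j⇡ y ⇔ app t⇡⇡ j⇡ y

/-- The family `D` contains the sets of assignments `s : w → A` given by `s i = s j` and by
`s i ∈ s j` for `i, j ∈ w`, and is closed under complement, intersection and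
projection along each coordinate `i ∈ w`. -/
def isDefClosed {n : ℕ} (w A D : Fin n) : SetFormula n :=
  (allIn w fun i => allIn w⇡ fun j => all fun R =>
    (all fun s => mem s R⇡ ⇔ (isFun s w⇡⇡⇡⇡ A⇡⇡⇡⇡ ⊓
      ex fun x => app s⇡ i⇡⇡⇡⇡ x ⊓ app s⇡ j⇡⇡⇡ x)) ⟹ mem R D⇡⇡⇡) ⊓
  (allIn w fun i => allIn w⇡ fun j => all fun R =>
    (all fun s => mem s R⇡ ⇔ (isFun s w⇡⇡⇡⇡ A⇡⇡⇡⇡ ⊓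
      ex fun x => ex fun y => app s⇡⇡ i⇡⇡⇡⇡⇡ x⇡ ⊓ app s⇡⇡ j⇡⇡⇡⇡ y ⊓ mem x⇡ y)) ⟹
        mem R D⇡⇡⇡) ⊓
  (allIn D fun Q => all fun R =>
    (all fun s => mem s R⇡ ⇔ (isFun s w⇡⇡⇡ A⇡⇡⇡ ⊓ ∼(mem s Q⇡⇡))) ⟹ mem R D⇡⇡) ⊓
  (allIn D fun P => allIn D⇡ fun Q => all fun R =>
    (all fun s => mem s R⇡ ⇔ (mem s P⇡⇡⇡ ⊓ mem s Q⇡⇡)) ⟹ mem R D⇡⇡⇡) ⊓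
  (allIn D fun Q => allIn w⇡ fun i => all fun R =>
    (all fun s => mem s R⇡ ⇔ (isFun s w⇡⇡⇡⇡ A⇡⇡⇡⇡ ⊓
      exIn Q⇡⇡⇡ fun t => agreeOff w⇡⇡⇡⇡⇡ s⇡ t i⇡⇡⇡)) ⟹ mem R D⇡⇡⇡)

/-- For `w = ω`: the relation `R ⊆ A^ω` is first-order definable without parameters over
the structure `(A, ∈)`, i.e. `R` is the set of assignments `s : ω → A` of the variables that
satisfy some (internal) formula in `(A, ∈)`. The family of these relations is the least
family containing the relations given by atomic formulas and closed under the operations given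
by the connectives and the quantifiers. -/
def isDefinableRel {n : ℕ} (w A R : Fin n) : SetFormula n :=
  all fun D => isDefClosed w⇡ A⇡ D ⟹ mem R⇡ D

/-- `a` is ordinal definable: for some ordinal `θ`, `a` is an element of `V_θ` that is
definable in `(V_θ, ∈)` with ordinal parameters below `θ`. Here `s` assigns the ordinal parameters to
the variables, the variable numbered `0 = z` is the one that stands for `a`. -/
def isOD {n : ℕ} (a : Fin n) : SetFormula n :=
  ex fun θ => ex fun A => isV θ⇡ A ⊓ mem a⇡⇡ A ⊓
    ex fun w => isOmega w ⊓ ex fun z => isEmpty z ⊓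
      ex fun R => isDefinableRel w⇡⇡ A⇡⇡⇡ R ⊓
        ex fun s => isFun s w⇡⇡⇡ θ⇡⇡⇡⇡⇡ ⊓
          allIn A⇡⇡⇡⇡ fun x =>
            (exIn R⇡⇡ fun t => agreeOff w⇡⇡⇡⇡⇡ s⇡⇡ t z⇡⇡⇡⇡ ⊓ app t z⇡⇡⇡⇡ x⇡) ⇔
              eq x a⇡⇡⇡⇡⇡⇡⇡

/-- `a` is hereditarily ordinal definable: `a` and all elements of its transitive closure are
ordinal definable. -/
def isHOD {n : ℕ} (a : Fin n) : SetFormula n :=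
  isOD a ⊓ all fun y => inTransitiveClosure y a⇡ ⟹ isOD y

/-- The sentence `V = HOD`. -/
def VeqHOD : LSet.Sentence :=
  all fun x => isHOD x

/-! ### Algebraic elements and algebraic structures -/

/-- `a` is algebraic in the structure `M`: it has some first-order property, expressed without
parameters, that only finitely many elements of `M` have. -/
def IsAlgebraicElement (L : FirstOrder.Language) (M : Type*) [L.Structure M] (a : M) : Prop :=
  ∃ φ : L.Formula (Fin 1), φ.Realize (fun _ => a) ∧ {b : M | φ.Realize (fun _ => b)}.Finite

/-- `M` is (pointwise) algebraic: each of its elements is algebraic in it. -/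
def IsPointwiseAlgebraic (L : FirstOrder.Language) (M : Type*) [L.Structure M] : Prop :=
  ∀ a : M, IsAlgebraicElement L M a

/-- `T` extends `T₀` (in the same language): every axiom of `T₀` is a consequence of `T`. -/
def Extends {L : FirstOrder.Language} (T T₀ : L.Theory) : Prop :=
  ∀ σ ∈ T₀, T ⊨ᵇ σ

/-- `T` is consistent with the sentence `σ`. -/
def IsConsistentWith {L : FirstOrder.Language} (T : L.Theory) (σ : L.Sentence) : Prop :=
  (T ∪ {σ}).IsSatisfiable

end SetTheoryLogic

universe u

/-! Two facts about a model `M` of `ZF` carry the proof. The first, `isOD_of_dfnC`: an element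
definable without parameters is ordinal definable, because by reflection some `V θ` contains it and
has, as an internally definable relation, the truth set of its defining formula. The second,
`exists_dfnC_of_isOD`: a definable property of some ordinal definable element is a property of a
definable element, because ordinal definable sets are definably coded by pairs of ordinals, and
least codes are definable.

If `M` is pointwise algebraic, `∈`-induction shows that every `a` is ordinal definable. Let the
elements of `a` be ordinal definable and let `a` lie in a finite definable set; shrink this to a set
`P` whose members all have only ordinal definable elements. Two distinct members of `P` differ at an
ordinal definable element, so by the second fact some definable `x` belongs to some members of `P`
and not to others. Asking whether `x ∈ a` leaves a smaller definable set containing `a`. After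
finitely many cuts `a` is alone, hence definable, hence ordinal definable.

Conversely, under `V = HOD` the second fact is the Tarski–Vaught criterion for the set of definable
elements. They form an elementary substructure in which each element is definable, so algebraic.

Since `ω` of `M` may be nonstandard, the internal formulas in the definition of ordinal definability
are not actual formulas. Reflection proceeds by induction on an actual formula, whereas the coding
is a transfinite recursion inside `M` (`enum`) that exhausts the definable relations over `V θ`. -/

namespace SetTheoryLogic
open FirstOrder FirstOrder.Language

/-! ### Definable predicates and functions, recognised by instance search. -/

section Definability

universe w
variable {M : Type w} [LSet.Structure M] {C : Set M}

/-- The membership relation of a structure for the language of set theory. -/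
def E (x y : M) : Prop := Structure.RelMap (L := LSet) MemRel.mem ![x, y]

infix:50 " ε " => E

/-- `P` is a first-order definable predicate of infinitely many variables, with parameters
from `C`. -/
class Dfn (C : Set M) (P : (ℕ → M) → Prop) : Prop where
  out : ∃ φ : LSet.Formula (C ⊕ ℕ), ∀ v, φ.Realize (Sum.elim Subtype.val v) ↔ P v

theorem Dfn.congr {P Q : (ℕ → M) → Prop} (h : Dfn C P) (hPQ : ∀ v, P v ↔ Q v) : Dfn C Q := by
  obtain ⟨φ, hφ⟩ := h.out
  exact ⟨φ, fun v => (hφ v).trans (hPQ v)⟩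

theorem Dfn.subst {P : (ℕ → M) → Prop} (h : Dfn C P) (r : ℕ → ℕ) :
    Dfn C fun v => P fun n => v (r n) := by
  obtain ⟨φ, hφ⟩ := h.out
  refine ⟨φ.relabel (Sum.map id r), fun v => ?_⟩
  rw [Formula.realize_relabel, ← hφ]
  exact iff_of_eq (congrArg _ (by ext (c | n) <;> rfl))

instance Dfn.const (p : Prop) : Dfn C fun _ => p := by
  by_cases h : p
  · exact ⟨⊤, fun v => by simp [h]⟩
  · exact ⟨⊥, fun v => by simp [h]⟩

instance Dfn.imp (P Q : (ℕ → M) → Prop) [hP : Dfn C P] [hQ : Dfn C Q] :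
    Dfn C fun v => P v → Q v := by
  obtain ⟨φ, hφ⟩ := hP.out
  obtain ⟨ψ, hψ⟩ := hQ.out
  exact ⟨φ.imp ψ, fun v => by rw [Formula.realize_imp, hφ, hψ]⟩

/-- De Bruijn convention: the bound variable becomes `v 0` and the outer variables move up by one.
All binder instances have a hypothesis of this shape, so instance search can descend through nested
binders. -/
instance Dfn.all (Q : (ℕ → M) → M → Prop) [h : Dfn C fun v => Q (fun n => v (n + 1)) (v 0)] :
    Dfn C fun v => ∀ x, Q v x := by
  obtain ⟨φ, hφ⟩ := h.out
  refine ⟨(φ.relabel (β := (C ⊕ ℕ) ⊕ Unit) (Sum.elim (fun c => Sum.inl (Sum.inl c))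
    fun n => Nat.casesOn n (Sum.inr ()) fun n => Sum.inl (Sum.inr n))).iAlls Unit, fun v => ?_⟩
  rw [Formula.realize_iAlls]
  have key : ∀ i : Unit → M, (Sum.elim (Sum.elim Subtype.val v) i ∘
      (Sum.elim (fun c => Sum.inl (Sum.inl c))
        fun n => Nat.casesOn n (Sum.inr ()) fun n => Sum.inl (Sum.inr n) :
          C ⊕ ℕ → (C ⊕ ℕ) ⊕ Unit)) =
      Sum.elim Subtype.val (fun n => Nat.casesOn n (i ()) v : ℕ → M) := by
    intro i
    ext (c | n)
    · rfl
    · cases n <;> rfl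
  simp only [Formula.realize_relabel, key, hφ]
  exact ⟨fun H x => H fun _ => x, fun H i => H (i ())⟩

instance Dfn.not (P : (ℕ → M) → Prop) [hP : Dfn C P] : Dfn C fun v => ¬P v :=
  Dfn.imp P fun _ => False

instance Dfn.and (P Q : (ℕ → M) → Prop) [Dfn C P] [Dfn C Q] : Dfn C fun v => P v ∧ Q v :=
  (inferInstance : Dfn C fun v => ¬(P v → ¬Q v)).congr fun v => by tauto

instance Dfn.or (P Q : (ℕ → M) → Prop) [Dfn C P] [Dfn C Q] : Dfn C fun v => P v ∨ Q v :=
  (inferInstance : Dfn C fun v => (¬P v → Q v)).congr fun v => by tauto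

instance Dfn.iff (P Q : (ℕ → M) → Prop) [Dfn C P] [Dfn C Q] : Dfn C fun v => P v ↔ Q v :=
  (inferInstance : Dfn C fun v => (P v → Q v) ∧ (Q v → P v)).congr fun v => by tauto

instance Dfn.ex (Q : (ℕ → M) → M → Prop) [h : Dfn C fun v => Q (fun n => v (n + 1)) (v 0)] :
    Dfn C fun v => ∃ x, Q v x :=
  (inferInstance : Dfn C fun v => ¬∀ x, ¬Q v x).congr fun v => by push Not; rfl

theorem Dfn.mem_var (i j : ℕ) : Dfn C fun v => v i ε v j :=
  ⟨Relations.formula₂ (L := LSet) MemRel.mem (Term.var (Sum.inr i)) (Term.var (Sum.inr j)),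
    fun _ => Formula.realize_rel₂⟩

theorem Dfn.eq_var (i j : ℕ) : Dfn C fun v => v i = v j :=
  ⟨Term.equal (Term.var (Sum.inr i)) (Term.var (Sum.inr j)), fun v => by
    simp [Formula.realize_equal]⟩

/-- `f` is a first-order definable function of infinitely many variables. -/
class DfnF (C : Set M) (f : (ℕ → M) → M) : Prop where
  out : Dfn C fun v => v 0 = f fun n => v (n + 1)

/-- Function terms are eliminated through their graphs: `P (f v)` becomes `∃ x, x = f v ∧ P x`. -/
theorem Dfn.comp {P : M → (ℕ → M) → Prop} (h : Dfn C fun v => P (v 0) fun n => v (n + 1))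
    (f : (ℕ → M) → M) [hf : DfnF C f] : Dfn C fun v => P (f v) v := by
  have := hf.out
  exact (inferInstance : Dfn C fun v => ∃ x, x = f v ∧ P x v).congr fun v => by simp

instance DfnF.var (i : ℕ) : DfnF C fun v => v i := ⟨Dfn.eq_var 0 (i + 1)⟩

instance DfnF.subst {f : (ℕ → M) → M} [h : DfnF C f] (r : ℕ → ℕ) :
    DfnF C fun v => f fun n => v (r n) :=
  ⟨h.out.subst fun n => Nat.casesOn n 0 fun n => r n + 1⟩

instance Dfn.subst_inst {P : (ℕ → M) → Prop} [h : Dfn C P] (r : ℕ → ℕ) :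
    Dfn C fun v => P fun n => v (r n) := h.subst r

instance Dfn.mem (f g : (ℕ → M) → M) [hf : DfnF C f] [hg : DfnF C g] :
    Dfn C fun v => f v ε g v :=
  Dfn.comp (P := fun x v => x ε g v) (Dfn.comp (P := fun y v => v 0 ε y) (Dfn.mem_var 1 0)
    (fun v => g fun n => v (n + 1))) f

instance Dfn.eq (f g : (ℕ → M) → M) [hf : DfnF C f] [hg : DfnF C g] :
    Dfn C fun v => f v = g v :=
  Dfn.comp (P := fun x v => x = g v) (Dfn.comp (P := fun y v => v 0 = y) (Dfn.eq_var 1 0)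
    (fun v => g fun n => v (n + 1))) f

theorem DfnF.of_graph {f : (ℕ → M) → M} (Q : (ℕ → M) → M → Prop)
    (hQ : ∀ v x, x = f v ↔ Q v x) [h : Dfn C fun v => Q (fun n => v (n + 1)) (v 0)] : DfnF C f :=
  ⟨h.congr fun _ => (hQ _ _).symm⟩

/-- An element that is definable with parameters from `C`. -/
class DfnC (C : Set M) (c : M) : Prop where
  out : DfnF C fun _ => c

instance DfnF.const (c : M) [h : DfnC C c] : DfnF C fun _ => c := h.out

/-- Two parameter sets matter: `Set.univ`, for which the schemes of separation and replacement
apply, and `∅`, for definability proper. -/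
instance DfnC.univ (c : M) : DfnC Set.univ c :=
  ⟨⟨⟨Term.equal (Term.var (Sum.inr 0)) (Term.var (Sum.inl ⟨c, trivial⟩)), fun v => by
    simp [Formula.realize_equal]⟩⟩⟩

theorem DfnC.of_unique {c : M} (Q : M → Prop) (hc : ∀ x, x = c ↔ Q x)
    [h : Dfn C fun v => Q (v 0)] : DfnC C c :=
  ⟨DfnF.of_graph (fun _ => Q) fun _ => hc⟩

open Classical in
/-- `x` if `p` holds, `y` otherwise. -/
noncomputable def pick (p : Prop) (x y : M) : M := if p then x else y

instance DfnF.pick (P : (ℕ → M) → Prop) (f g : (ℕ → M) → M) [Dfn C P] [DfnF C f] [DfnF C g] :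
    DfnF C fun v => pick (P v) (f v) (g v) :=
  DfnF.of_graph (fun v x => P v ∧ x = f v ∨ ¬P v ∧ x = g v) fun v x => by
    unfold SetTheoryLogic.pick; split <;> simp [*]

theorem exists_term_eq_var {n : ℕ} (t : LSet.Term (Empty ⊕ Fin n)) :
    ∃ i, t = Term.var (Sum.inr i) := by
  cases t with
  | var x =>
    rcases x with e | i
    · exact e.elim
    · exact ⟨i, rfl⟩
  | func F _ => exact Empty.elim F

theorem realize_rel {n : ℕ} (ts : Fin 2 → LSet.Term (Empty ⊕ Fin n)) (i j : Fin n)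
    (hi : ts 0 = Term.var (Sum.inr i)) (hj : ts 1 = Term.var (Sum.inr j))
    (xs : Fin n → M) (u : Empty → M) :
    BoundedFormula.Realize (L := LSet) (BoundedFormula.rel MemRel.mem ts) u xs ↔
      xs i ε xs j := by
  refine iff_of_eq (congrArg (Structure.RelMap (L := LSet) MemRel.mem) ?_)
  ext k
  fin_cases k <;> simp [hi, hj]

theorem DfnF.snoc {n : ℕ} (f : Fin n → (ℕ → M) → M) (g : (ℕ → M) → M)
    [hf : ∀ i, DfnF C (f i)] [hg : DfnF C g] (i : Fin (n + 1)) :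
    DfnF C fun v => Fin.snoc (α := fun _ => M) (fun i => f i v) (g v) i := by
  refine Fin.lastCases ?_ (fun i => ?_) i
  · simpa using hg
  · simpa using hf i

/-- This feeds arbitrary actual formulas into the calculus, as reflection and the Tarski–Vaught test
require. -/
instance Dfn.realize {n : ℕ} (φ : SetFormula n) (f : Fin n → (ℕ → M) → M)
    [hf : ∀ i, DfnF C (f i)] : Dfn C fun v => φ.Realize default fun i => f i v := by
  induction φ with
  | falsum => exact Dfn.const False
  | equal t₁ t₂ =>
    obtain ⟨i, rfl⟩ := exists_term_eq_var t₁
    obtain ⟨j, rfl⟩ := exists_term_eq_var t₂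
    exact Dfn.eq (f i) (f j)
  | rel R ts =>
    cases R
    obtain ⟨i, hi⟩ := exists_term_eq_var (ts 0)
    obtain ⟨j, hj⟩ := exists_term_eq_var (ts 1)
    exact (Dfn.mem (f i) (f j)).congr fun v =>
      (realize_rel ts i j hi hj (fun i => f i v) default).symm
  | imp _ _ h₁ h₂ =>
    have := h₁ f
    have := h₂ f
    exact Dfn.imp _ _
  | all ψ ih =>
    have : ∀ i, DfnF C fun v => f i fun n => v (n + 1) := fun i => DfnF.subst (h := hf i) _
    have h := DfnF.snoc (C := C) (fun i (v : ℕ → M) => f i fun n => v (n + 1)) fun v => v 0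
    exact @Dfn.all _ _ _ (fun v x => ψ.Realize default
      (Fin.snoc (α := fun _ => M) (fun i => f i v) x)) (ih _)

instance Dfn.realize_snoc {n : ℕ} (φ : SetFormula (n + 1)) (f : Fin n → (ℕ → M) → M)
    (g : (ℕ → M) → M) [hf : ∀ i, DfnF C (f i)] [hg : DfnF C g] :
    Dfn C fun v => φ.Realize default (Fin.snoc (α := fun _ => M) (fun i => f i v) (g v)) := by
  have := DfnF.snoc (C := C) f g
  exact Dfn.realize φ fun i v => Fin.snoc (α := fun _ => M) (fun i => f i v) (g v) i

/-- Without parameters, all variables can be identified with the single variable of a `Formula (Fin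
1)`. -/
theorem Dfn.exists_formula {P : M → Prop} (h : Dfn ∅ fun v => P (v 0)) :
    ∃ φ : LSet.Formula (Fin 1), ∀ x, φ.Realize (fun _ => x) ↔ P x := by
  obtain ⟨φ, hφ⟩ := h.out
  refine ⟨φ.relabel (Sum.elim (fun c => c.2.elim) fun _ => 0), fun x => ?_⟩
  rw [Formula.realize_relabel, ← hφ fun _ => x]
  exact iff_of_eq (congrArg _ (by ext (c | n); exacts [c.2.elim, rfl]))

/-! ### Realization of the formulas of set theory -/

section Realize

variable {n : ℕ} (u : Empty → M) (xs : Fin n → M)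

@[simp] theorem realize_mem (x y : Fin n) : (mem x y).Realize u xs ↔ xs x ε xs y :=
  BoundedFormula.realize_rel₂

@[simp] theorem realize_eq (x y : Fin n) : (eq x y).Realize u xs ↔ xs x = xs y :=
  Iff.rfl

@[simp] theorem realize_all (φ : Fin (n + 1) → SetFormula (n + 1)) :
    (all φ).Realize u xs ↔ ∀ a : M, (φ (Fin.last n)).Realize u (Fin.snoc xs a) :=
  Iff.rfl

@[simp] theorem realize_ex (φ : Fin (n + 1) → SetFormula (n + 1)) :
    (ex φ).Realize u xs ↔ ∃ a : M, (φ (Fin.last n)).Realize u (Fin.snoc xs a) :=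
  BoundedFormula.realize_ex

@[simp] theorem realize_allIn (x : Fin n) (φ : Fin (n + 1) → SetFormula (n + 1)) :
    (allIn x φ).Realize u xs ↔
      ∀ a : M, a ε xs x → (φ (Fin.last n)).Realize u (Fin.snoc xs a) := by
  simp [allIn]

@[simp] theorem realize_exIn (x : Fin n) (φ : Fin (n + 1) → SetFormula (n + 1)) :
    (exIn x φ).Realize u xs ↔
      ∃ a : M, a ε xs x ∧ (φ (Fin.last n)).Realize u (Fin.snoc xs a) := by
  simp [exIn]

@[simp] theorem realize_inst {α : Type} (φ : LSet.Formula α) (v : α → Fin n) :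
    (inst φ v).Realize u xs ↔ φ.Realize fun i => xs (v i) := by
  unfold inst
  rw [BoundedFormula.realize_relabel, Formula.Realize]
  exact iff_of_eq (congrArg₂ _ (by ext; simp) (Subsingleton.elim _ _))

end Realize

/-! The relations on a structure that the formulas of set theory express. -/

def Subset (x y : M) : Prop := ∀ z, z ε x → z ε y
def IsEmp (x : M) : Prop := ∀ z, ¬z ε x
def IsSucc (y x : M) : Prop := ∀ z, z ε y ↔ z ε x ∨ z = x
def IsUPair (p x y : M) : Prop := ∀ z, z ε p ↔ z = x ∨ z = y
def IsPair (p x y : M) : Prop := ∀ z, z ε p ↔ IsUPair z x x ∨ IsUPair z x y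
def App (f x y : M) : Prop := ∃ p, p ε f ∧ IsPair p x y
def IsFunOn (f d : M) : Prop :=
  (∀ p, p ε f → ∃ x, x ε d ∧ ∃ y, IsPair p x y) ∧
    ∀ x, x ε d → ∃ y, App f x y ∧ ∀ z, App f x z → z = y
def IsFun (f d c : M) : Prop := IsFunOn f d ∧ ∀ x y, App f x y → y ε c
def IsTrans (x : M) : Prop := ∀ y, y ε x → Subset y x
def IsOrd (x : M) : Prop := IsTrans x ∧ ∀ y, y ε x → IsTrans y
def IsInd (x : M) : Prop := (∃ e, e ε x ∧ IsEmp e) ∧ ∀ y, y ε x → ∃ z, z ε x ∧ IsSucc z y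
def IsOmega (w : M) : Prop := IsInd w ∧ ∀ x, IsInd x → Subset w x
def IsV (θ A : M) : Prop :=
  IsOrd θ ∧ ∃ d, IsSucc d θ ∧ ∃ f, (IsFunOn f d ∧
    (∀ β, β ε d → ∀ B, App f β B →
      ∀ x, x ε B ↔ ∃ γ, γ ε β ∧ ∃ C, App f γ C ∧ Subset x C)) ∧ App f θ A
def AgreeOff (w s t i : M) : Prop := ∀ j, j ε w → ¬j = i → ∀ y, App s j y ↔ App t j y
def IsDefClosed (w A D : M) : Prop :=
  (∀ i, i ε w → ∀ j, j ε w → ∀ R,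
    (∀ s, s ε R ↔ IsFun s w A ∧ ∃ x, App s i x ∧ App s j x) → R ε D) ∧
  (∀ i, i ε w → ∀ j, j ε w → ∀ R,
    (∀ s, s ε R ↔ IsFun s w A ∧ ∃ x y, App s i x ∧ App s j y ∧ x ε y) → R ε D) ∧
  (∀ Q, Q ε D → ∀ R, (∀ s, s ε R ↔ IsFun s w A ∧ ¬s ε Q) → R ε D) ∧
  (∀ P, P ε D → ∀ Q, Q ε D → ∀ R, (∀ s, s ε R ↔ s ε P ∧ s ε Q) → R ε D) ∧
  (∀ Q, Q ε D → ∀ i, i ε w → ∀ R,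
    (∀ s, s ε R ↔ IsFun s w A ∧ ∃ t, t ε Q ∧ AgreeOff w s t i) → R ε D)
def IsDefinableRel (w A R : M) : Prop := ∀ D, IsDefClosed w A D → R ε D
def IsOD (a : M) : Prop :=
  ∃ θ A, (IsV θ A ∧ a ε A) ∧ ∃ w, IsOmega w ∧ ∃ z, IsEmp z ∧ ∃ R, IsDefinableRel w A R ∧
    ∃ s, IsFun s w θ ∧ ∀ x, x ε A → ((∃ t, t ε R ∧ AgreeOff w s t z ∧ App t z x) ↔ x = a)

section Realize

variable {n : ℕ} (u : Empty → M) (xs : Fin n → M)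

@[simp] theorem realize_subset (x y : Fin n) :
    (subset x y).Realize u xs ↔ Subset (xs x) (xs y) := by
  simp [subset, Subset]

@[simp] theorem realize_isEmpty (x : Fin n) : (isEmpty x).Realize u xs ↔ IsEmp (xs x) := by
  simp [isEmpty, IsEmp]

@[simp] theorem realize_isSucc (y x : Fin n) :
    (isSucc y x).Realize u xs ↔ IsSucc (xs y) (xs x) := by
  simp [isSucc, IsSucc]

@[simp] theorem realize_isUnorderedPair (p x y : Fin n) :
    (isUnorderedPair p x y).Realize u xs ↔ IsUPair (xs p) (xs x) (xs y) := by
  simp [isUnorderedPair, IsUPair]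

@[simp] theorem realize_isPair (p x y : Fin n) :
    (isPair p x y).Realize u xs ↔ IsPair (xs p) (xs x) (xs y) := by
  simp [isPair, IsPair]

@[simp] theorem realize_app (f x y : Fin n) :
    (app f x y).Realize u xs ↔ App (xs f) (xs x) (xs y) := by
  simp [app, App]

@[simp] theorem realize_isFunOn (f d : Fin n) :
    (isFunOn f d).Realize u xs ↔ IsFunOn (xs f) (xs d) := by
  simp [isFunOn, IsFunOn]

@[simp] theorem realize_isFun (f d c : Fin n) :
    (isFun f d c).Realize u xs ↔ IsFun (xs f) (xs d) (xs c) := by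
  simp [isFun, IsFun]

@[simp] theorem realize_isTransitive (x : Fin n) :
    (isTransitive x).Realize u xs ↔ IsTrans (xs x) := by
  simp [isTransitive, IsTrans]

@[simp] theorem realize_isOrdinal (x : Fin n) :
    (isOrdinal x).Realize u xs ↔ IsOrd (xs x) := by
  simp [isOrdinal, IsOrd]

@[simp] theorem realize_isInductive (x : Fin n) :
    (isInductive x).Realize u xs ↔ IsInd (xs x) := by
  simp [isInductive, IsInd]

@[simp] theorem realize_isOmega (x : Fin n) :
    (isOmega x).Realize u xs ↔ IsOmega (xs x) := by
  simp [isOmega, IsOmega]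

@[simp] theorem realize_isV (θ A : Fin n) : (isV θ A).Realize u xs ↔ IsV (xs θ) (xs A) := by
  simp [isV, IsV]

@[simp] theorem realize_agreeOff (w s t i : Fin n) :
    (agreeOff w s t i).Realize u xs ↔ AgreeOff (xs w) (xs s) (xs t) (xs i) := by
  simp [agreeOff, AgreeOff]

@[simp] theorem realize_isDefClosed (w A D : Fin n) :
    (isDefClosed w A D).Realize u xs ↔ IsDefClosed (xs w) (xs A) (xs D) := by
  simp [isDefClosed, IsDefClosed, and_assoc]

@[simp] theorem realize_isDefinableRel (w A R : Fin n) :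
    (isDefinableRel w A R).Realize u xs ↔ IsDefinableRel (xs w) (xs A) (xs R) := by
  simp [isDefinableRel, IsDefinableRel]

@[simp] theorem realize_isOD (a : Fin n) : (isOD a).Realize u xs ↔ IsOD (xs a) := by
  simp [isOD, IsOD]

end Realize

/-- The hereditary clause is redundant once ordinal definability is asserted of all sets. -/
theorem realize_VeqHOD : M ⊨ VeqHOD ↔ ∀ a : M, IsOD a := by
  simp only [Sentence.Realize, Formula.Realize, VeqHOD, isHOD, realize_all,
    BoundedFormula.realize_inf, realize_isOD, Fin.snoc_last, BoundedFormula.realize_imp]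
  exact ⟨fun h a => (h a).1, fun h a => ⟨h a, fun y _ => h y⟩⟩

end Definability

/-! ### The axioms of `ZF` for definable classes, and set-builder terms. -/

section Sets

universe w
variable {M : Type w} [LSet.Structure M] {C : Set M}

/-- Variables frozen at elements of `M` become parameters, so definability over any `C` passes to
definability over `M`. -/
theorem Dfn.fix {P : (ℕ → M) → Prop} (h : Dfn C P) (g : ℕ → M ⊕ ℕ) :
    Dfn Set.univ fun v => P fun n => Sum.elim id v (g n) := by
  obtain ⟨φ, hφ⟩ := h.out
  refine ⟨φ.relabel (Sum.elim (fun c => Sum.inl ⟨c.1, trivial⟩)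
    fun n => (g n).elim (fun c => Sum.inl ⟨c, trivial⟩) Sum.inr), fun v => ?_⟩
  rw [Formula.realize_relabel, ← hφ]
  refine iff_of_eq (congrArg _ ?_)
  ext (c | n)
  · rfl
  · simp only [Function.comp, Sum.elim_inr]
    cases g n <;> rfl

theorem Dfn.section {P : (ℕ → M) → M → Prop} (h : Dfn C fun v => P (fun n => v (n + 1)) (v 0))
    (v : ℕ → M) : Dfn Set.univ fun w => P v (w 0) := by
  let g : ℕ → M ⊕ ℕ
    | 0 => Sum.inr 0
    | n + 1 => Sum.inl (v n)
  exact h.fix g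

theorem Dfn.comp₂ {P : (ℕ → M) → M → Prop} (h : Dfn C fun v => P (fun n => v (n + 1)) (v 0))
    (r : ℕ → ℕ) (i : ℕ) : Dfn C fun v => P (fun n => v (r n)) (v i) :=
  h.subst fun n => Nat.casesOn n i r

theorem DfnF.comp {P : (ℕ → M) → M → M} (h : DfnF C fun v => P (fun n => v (n + 1)) (v 0))
    (f : (ℕ → M) → M) [hf : DfnF C f] : DfnF C fun v => P v (f v) :=
  ⟨Dfn.comp (P := fun x v => v 0 = P (fun n => v (n + 1)) x)
    (h.out.subst fun n => Nat.casesOn n 1 fun n => Nat.casesOn n 0 fun n => n + 2)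
    (fun v => f fun n => v (n + 1))⟩

/-- A formula has finitely many free symbols, so only finitely many parameters occur; this is the
form in which the axiom schemes take them. -/
theorem Dfn.exists_formula_params {P : (ℕ → M) → Prop} (h : Dfn C P) {β : Type} (g : ℕ → β) :
    ∃ (n : ℕ) (c : Fin n → M) (ψ : LSet.Formula (Fin n ⊕ β)),
      ∀ u : β → M, ψ.Realize (Sum.elim c u) ↔ P fun n => u (g n) := by
  classical
  obtain ⟨φ, hφ⟩ := h.out
  rcases isEmpty_or_nonempty M with hM | ⟨⟨m⟩⟩
  · refine ⟨0, Fin.elim0, ⊥, fun u => (hM.false (u (g 0))).elim⟩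
  let e := φ.freeVarFinset.equivFin
  -- Every free symbol gets one of the `n` slots, even those that are not parameters; `m` fills the
  -- latter and is never read.
  refine ⟨_, fun i => (e.symm i).1.elim (fun c => c.1) fun _ => m,
    φ.restrictFreeVar fun a => a.1.elim (fun _ => Sum.inl (e a)) fun k => Sum.inr (g k),
    fun u => ?_⟩
  rw [← hφ, Formula.Realize, BoundedFormula.realize_restrictFreeVar
    (Sum.elim Subtype.val fun n => u (g n))]
  · rfl
  · rintro ⟨c | k, hk⟩ <;> simp

section Axioms

variable [hZF : M ⊨ ZF]

theorem eq_of_mem_iff {x y : M} (h : ∀ z, z ε x ↔ z ε y) : x = y := by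
  have := hZF.realize_of_mem extensionality (by simp [ZF])
  simp only [Sentence.Realize, Formula.Realize, extensionality, realize_all,
    BoundedFormula.realize_imp, BoundedFormula.realize_iff, realize_mem, realize_eq,
    Fin.snoc_last, Fin.snoc_castSucc] at this
  exact this x y h

theorem exists_min (x : M) (h : ∃ y, y ε x) : ∃ y, y ε x ∧ ∀ z, z ε y → ¬z ε x := by
  have := hZF.realize_of_mem foundation (by simp [ZF])
  simp only [Sentence.Realize, Formula.Realize, foundation, realize_all, realize_ex, realize_exIn,
    realize_allIn, BoundedFormula.realize_not, BoundedFormula.realize_imp, realize_mem,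
    Fin.snoc_last, Fin.snoc_castSucc] at this
  exact this x h

theorem exists_pairing (x y : M) : ∃ p : M, ∀ z, z ε p ↔ z = x ∨ z = y := by
  have := hZF.realize_of_mem pairing (by simp [ZF])
  simp only [Sentence.Realize, Formula.Realize, pairing, realize_all, realize_ex,
    realize_isUnorderedPair, Fin.snoc_last, Fin.snoc_castSucc] at this
  exact this x y

theorem exists_sUnion (x : M) : ∃ u : M, ∀ z, z ε u ↔ ∃ y, y ε x ∧ z ε y := by
  have := hZF.realize_of_mem union (by simp [ZF])
  simp only [Sentence.Realize, Formula.Realize, union, realize_all, realize_ex, realize_exIn,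
    realize_mem, BoundedFormula.realize_iff, Fin.snoc_last, Fin.snoc_castSucc] at this
  exact this x

theorem exists_powerset (x : M) : ∃ u : M, ∀ z, z ε u ↔ Subset z x := by
  have := hZF.realize_of_mem powerset (by simp [ZF])
  simp only [Sentence.Realize, Formula.Realize, powerset, realize_all, realize_ex,
    realize_mem, realize_subset, BoundedFormula.realize_iff, Fin.snoc_last,
    Fin.snoc_castSucc] at this
  exact this x

variable (M) in
theorem exists_isInd : ∃ x : M, IsInd x := by
  have := hZF.realize_of_mem infinity (by simp [ZF])
  simpa only [Sentence.Realize, Formula.Realize, infinity, realize_ex,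
    realize_isInductive, Fin.snoc_last] using this

theorem exists_sep (a : M) (P : M → Prop) [h : Dfn Set.univ fun v => P (v 0)] :
    ∃ b : M, ∀ x, x ε b ↔ x ε a ∧ P x := by
  obtain ⟨n, c, ψ, hψ⟩ := h.exists_formula_params fun _ => (0 : Fin 1)
  have := hZF.realize_of_mem (separation n ψ) (by simp only [ZF]; exact .inl (.inr ⟨n, ψ, rfl⟩))
  simp only [Sentence.Realize, separation, BoundedFormula.realize_alls, realize_all, realize_ex,
    realize_mem, BoundedFormula.realize_iff, BoundedFormula.realize_inf, Fin.snoc_last,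
    Fin.snoc_castSucc, realize_inst] at this
  obtain ⟨b, hb⟩ := this c a
  refine ⟨b, fun x => (hb x).trans (and_congr_right fun _ => ?_)⟩
  rw [← hψ fun _ => x]
  refine iff_of_eq (congrArg _ ?_)
  ext (i | i)
  · simp
  · simp [Subsingleton.elim i 0]

theorem exists_image (a : M) (F : M → M) [h : DfnF Set.univ fun v => F (v 0)] :
    ∃ b : M, ∀ y, y ε b ↔ ∃ x, x ε a ∧ y = F x := by
  have h' : Dfn Set.univ fun v : ℕ → M => v 1 = F (v 0) := inferInstance
  obtain ⟨n, c, ψ, hψ⟩ := h'.exists_formula_params fun k => if k = 0 then (0 : Fin 2) else 1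
  have := hZF.realize_of_mem (replacement n ψ) (by simp only [ZF]; exact .inr ⟨n, ψ, rfl⟩)
  simp only [Sentence.Realize, replacement, BoundedFormula.realize_alls, realize_all, realize_ex,
    realize_exIn, realize_allIn, BoundedFormula.realize_imp, realize_eq,
    realize_mem, BoundedFormula.realize_iff, BoundedFormula.realize_inf, Fin.snoc_last,
    Fin.snoc_castSucc, realize_inst] at this
  have key : ∀ (d : Fin n ⊕ Fin 2 → M) (x y : M), (∀ i, d (Sum.inl i) = c i) →
      d (Sum.inr 0) = x → d (Sum.inr 1) = y → (ψ.Realize d ↔ y = F x) := by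
    intro d x y h1 h2 h3
    have hd : d = Sum.elim c ![x, y] := by
      ext (i | i)
      · simp [h1]
      · fin_cases i <;> simp [h2, h3]
    rw [hd, hψ]
    simp
  obtain ⟨b, hb⟩ := this c a (fun x _ y z hyz => by
    rw [key _ x y, key _ x z] at hyz <;> simp_all)
  refine ⟨b, fun y => (hb y).trans (exists_congr fun x => and_congr_right fun _ => ?_)⟩
  rw [key _ x y] <;> simp

end Axioms

open Classical in
/-- The set `{x | P x}` if there is one, and otherwise the empty set if there is one. -/
noncomputable def mk [Nonempty M] (P : M → Prop) : M :=
  if h : ∃ b : M, ∀ x, x ε b ↔ P x then h.choose else Classical.epsilon IsEmp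

theorem mem_mk [Nonempty M] {P : M → Prop} (h : ∃ b : M, ∀ x, x ε b ↔ P x) (x : M) :
    x ε mk P ↔ P x := by
  rw [mk, dif_pos h, h.choose_spec x]

variable [Nonempty M] [hZF : M ⊨ ZF]

variable (M) in
theorem exists_isEmp : ∃ x : M, IsEmp x := by
  obtain ⟨b, hb⟩ := exists_sep (Classical.arbitrary M) fun _ => False
  exact ⟨b, fun x hx => ((hb x).1 hx).2⟩

/-- With the empty set as default value, `mk` is total and its graph is first-order. Definability of
a set-builder term therefore needs no proof that the set exists. -/
theorem eq_mk_iff {P : M → Prop} {y : M} :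
    y = mk P ↔ (∀ x, x ε y ↔ P x) ∨ (¬∃ b : M, ∀ x, x ε b ↔ P x) ∧ IsEmp y := by
  by_cases h : ∃ b : M, ∀ x, x ε b ↔ P x
  · simp only [h, not_true, false_and, or_false]
    exact ⟨fun e => e ▸ mem_mk h, fun e => eq_of_mem_iff fun z => (e z).trans (mem_mk h z).symm⟩
  · have : IsEmp (mk P) := by
      rw [mk, dif_neg h]
      exact Classical.epsilon_spec (exists_isEmp M)
    simp only [h, not_false_iff, true_and]
    refine ⟨fun e => .inr (e ▸ this), fun e => e.elim (fun e => (h ⟨y, e⟩).elim) fun e =>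
      eq_of_mem_iff fun z => iff_of_false (e z) (this z)⟩

instance dfnF_mk (P : (ℕ → M) → M → Prop) [h : Dfn C fun v => P (fun n => v (n + 1)) (v 0)] :
    DfnF C fun v => mk (P v) := by
  have h1 := h.comp₂ (fun n => n + 2) 0
  have h2 := h.comp₂ (fun n => n + 3) 0
  exact DfnF.of_graph (fun v y => (∀ x, x ε y ↔ P v x) ∨ (¬∃ b : M, ∀ x, x ε b ↔ P v x) ∧
    ∀ z, ¬z ε y) fun v y => eq_mk_iff

end Sets

/-! ### Definability of the relations used in `IsOD`. -/

section Definability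

universe w
variable {M : Type w} [LSet.Structure M] {C : Set M}
variable (f g h k : (ℕ → M) → M) [DfnF C f] [DfnF C g] [DfnF C h] [DfnF C k]

instance : Dfn C fun v => Subset (f v) (g v) := by unfold Subset; infer_instance
instance : Dfn C fun v => IsEmp (f v) := by unfold IsEmp; infer_instance
instance : Dfn C fun v => IsSucc (f v) (g v) := by unfold IsSucc; infer_instance
instance : Dfn C fun v => IsUPair (f v) (g v) (h v) := by unfold IsUPair; infer_instance
instance : Dfn C fun v => IsPair (f v) (g v) (h v) := by unfold IsPair; infer_instance
instance : Dfn C fun v => App (f v) (g v) (h v) := by unfold App; infer_instance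
instance : Dfn C fun v => IsFunOn (f v) (g v) := by unfold IsFunOn; infer_instance
instance : Dfn C fun v => IsFun (f v) (g v) (h v) := by unfold IsFun; infer_instance
instance : Dfn C fun v => IsTrans (f v) := by unfold IsTrans; infer_instance
instance : Dfn C fun v => IsOrd (f v) := by unfold IsOrd; infer_instance
instance : Dfn C fun v => IsInd (f v) := by unfold IsInd; infer_instance
instance : Dfn C fun v => IsOmega (f v) := by unfold IsOmega; infer_instance
instance : Dfn C fun v => IsV (f v) (g v) := by unfold IsV; infer_instance
instance : Dfn C fun v => AgreeOff (f v) (g v) (h v) (k v) := by unfold AgreeOff; infer_instance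
set_option synthInstance.maxHeartbeats 400000 in
set_option synthInstance.maxSize 2000 in
instance : Dfn C fun v => IsDefClosed (f v) (g v) (h v) := by unfold IsDefClosed; infer_instance
instance : Dfn C fun v => IsDefinableRel (f v) (g v) (h v) := by
  unfold IsDefinableRel; infer_instance
instance : Dfn C fun v => IsOD (f v) := by unfold IsOD; infer_instance

end Definability

/-! ### Set operations as total definable functions, ordinals, and recursion. -/

section Operations

set_option linter.unusedSectionVars false

universe w
variable {M : Type w} [LSet.Structure M] {C : Set M} [Nonempty M]

variable (M) in
noncomputable def emp : M := mk fun _ => False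
noncomputable def upair (x y : M) : M := mk fun z => z = x ∨ z = y
noncomputable def pair (x y : M) : M := upair (upair x x) (upair x y)
noncomputable def sUn (x : M) : M := mk fun z => ∃ y, y ε x ∧ z ε y
noncomputable def pow (x : M) : M := mk fun z => Subset z x
noncomputable def suc (x : M) : M := mk fun z => z ε x ∨ z = x
noncomputable def sep (a : M) (P : M → Prop) : M := mk fun x => x ε a ∧ P x
noncomputable def img (a : M) (F : M → M) : M := mk fun y => ∃ x, x ε a ∧ y = F x
-- The union of all values is the value when it is unique. `least`, `omega` and `ordRec` name a
-- unique object through its elements in the same way, which keeps them definable without choice.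
noncomputable def ap (f x : M) : M := mk fun z => ∃ y, App f x y ∧ z ε y
noncomputable def lam (d : M) (F : M → M) : M := img d fun x => pair x (F x)
noncomputable def funs (d c : M) : M := mk fun f => IsFun f d c
def IsLeast' (P : M → Prop) (α : M) : Prop := IsOrd α ∧ P α ∧ ∀ β, β ε α → ¬P β
noncomputable def least (P : M → Prop) : M := mk fun z => ∃ α, IsLeast' P α ∧ z ε α
variable (M) in
noncomputable def omega : M := mk fun z => ∃ w, IsOmega w ∧ z ε w

variable [hZF : M ⊨ ZF]

section Instances

variable (f g h : (ℕ → M) → M) [DfnF C f] [DfnF C g] [DfnF C h]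

instance : DfnC C (emp M) := ⟨by unfold emp; infer_instance⟩
instance : DfnF C fun v => upair (f v) (g v) := by unfold upair; infer_instance
instance : DfnF C fun v => pair (f v) (g v) := by unfold pair; infer_instance
instance : DfnF C fun v => sUn (f v) := by unfold sUn; infer_instance
instance : DfnF C fun v => pow (f v) := by unfold pow; infer_instance
instance : DfnF C fun v => suc (f v) := by unfold suc; infer_instance
instance (P : (ℕ → M) → M → Prop) [Dfn C fun v => P (fun n => v (n + 1)) (v 0)] :
    DfnF C fun v => sep (f v) (P v) := by unfold sep; infer_instance
instance (F : (ℕ → M) → M → M) [hF : DfnF C fun v => F (fun n => v (n + 1)) (v 0)] :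
    DfnF C fun v => img (f v) (F v) := by
  have : DfnF C fun v => F (fun n => v (n + 2)) (v 0) :=
    DfnF.subst (h := hF) fun n => Nat.casesOn n 0 fun n => n + 2
  unfold img; infer_instance
instance : DfnF C fun v => ap (f v) (g v) := by unfold ap; infer_instance
instance (F : (ℕ → M) → M → M) [hF : DfnF C fun v => F (fun n => v (n + 1)) (v 0)] :
    DfnF C fun v => lam (f v) (F v) := by unfold lam; infer_instance
instance : DfnF C fun v => funs (f v) (g v) := by unfold funs; infer_instance
instance (P : (ℕ → M) → M → Prop) [hP : Dfn C fun v => P (fun n => v (n + 1)) (v 0)] :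
    DfnF C fun v => least (P v) := by
  have h1 := hP.comp₂ (fun n => n + 2) 0
  have h2 := hP.comp₂ (fun n => n + 3) 0
  unfold least IsLeast'; infer_instance
instance (P : (ℕ → M) → M → Prop) [hP : Dfn C fun v => P (fun n => v (n + 1)) (v 0)] :
    Dfn C fun v => IsLeast' (P v) (f v) := by
  have h1 := Dfn.comp (P := fun x v => P v x) hP f
  have h2 := hP.comp₂ (fun n => n + 1) 0
  unfold IsLeast'; infer_instance
instance : DfnC C (omega M) := ⟨by unfold omega; infer_instance⟩

end Instances

theorem DfnF.comp₁ (F : M → M) [hF : DfnF C fun v => F (v 0)] (f : (ℕ → M) → M) [DfnF C f] :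
    DfnF C fun v => F (f v) :=
  DfnF.comp (P := fun _ x => F x) hF f

theorem DfnF.comp₂ (F : M → M → M) [hF : DfnF C fun v => F (v 0) (v 1)] (f g : (ℕ → M) → M)
    [DfnF C f] [DfnF C g] : DfnF C fun v => F (f v) (g v) := by
  have h1 : DfnF C fun v => F (v 0) (g fun n => v (n + 1)) :=
    DfnF.comp (P := fun v y => F (v 0) y)
      (DfnF.subst (h := hF) fun n => Nat.casesOn n 1 fun _ => 0) (fun v => g fun n => v (n + 1))
  exact DfnF.comp (P := fun v x => F x (g v)) h1 f

theorem Dfn.comp₁ (P : M → Prop) [hP : Dfn C fun v => P (v 0)] (f : (ℕ → M) → M) [DfnF C f] :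
    Dfn C fun v => P (f v) :=
  Dfn.comp (P := fun x _ => P x) hP f

theorem Dfn.comp_rel (K : M → M → Prop) [hK : Dfn C fun v => K (v 0) (v 1)]
    (f g : (ℕ → M) → M) [DfnF C f] [DfnF C g] : Dfn C fun v => K (f v) (g v) := by
  have h1 : Dfn C fun v => K (v 0) (g fun n => v (n + 1)) :=
    Dfn.comp (P := fun y v => K (v 0) y)
      (hK.subst fun n => Nat.casesOn n 1 fun _ => 0) (fun v => g fun n => v (n + 1))
  exact Dfn.comp (P := fun x v => K x (g v)) h1 f

/-! ### Elementary set theory -/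

theorem not_mem_emp (x : M) : ¬x ε emp M := by
  unfold emp
  rw [mem_mk]
  · exact id
  · obtain ⟨b, hb⟩ := exists_isEmp M
    exact ⟨b, fun x => iff_of_false (hb x) id⟩

theorem isEmp_iff {x : M} : IsEmp x ↔ x = emp M :=
  ⟨fun h => eq_of_mem_iff fun z => iff_of_false (h z) (not_mem_emp z),
    fun h => h ▸ not_mem_emp⟩

@[simp] theorem mem_upair {x y z : M} : z ε upair x y ↔ z = x ∨ z = y :=
  mem_mk (exists_pairing x y) z

@[simp] theorem mem_sUn {x z : M} : z ε sUn x ↔ ∃ y, y ε x ∧ z ε y :=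
  mem_mk (exists_sUnion x) z

@[simp] theorem mem_pow {x z : M} : z ε pow x ↔ Subset z x :=
  mem_mk (exists_powerset x) z

@[simp] theorem mem_suc {x z : M} : z ε suc x ↔ z ε x ∨ z = x :=
  mem_mk ⟨sUn (upair x (upair x x)), fun z => by simp⟩ z

theorem mem_sep {a z : M} {P : M → Prop} [h : Dfn Set.univ fun v => P (v 0)] :
    z ε sep a P ↔ z ε a ∧ P z :=
  mem_mk (exists_sep a P) z

theorem mem_img {a z : M} {F : M → M} [h : DfnF Set.univ fun v => F (v 0)] :
    z ε img a F ↔ ∃ x, x ε a ∧ z = F x :=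
  mem_mk (exists_image a F) z

theorem isUPair_iff {p x y : M} : IsUPair p x y ↔ p = upair x y :=
  ⟨fun h => eq_of_mem_iff fun z => (h z).trans mem_upair.symm, fun h => h ▸ fun _ => mem_upair⟩

theorem isPair_iff {p x y : M} : IsPair p x y ↔ p = pair x y := by
  simp only [IsPair, isUPair_iff]
  exact isUPair_iff (p := p)

theorem isSucc_iff {x y : M} : IsSucc y x ↔ y = suc x :=
  ⟨fun h => eq_of_mem_iff fun z => (h z).trans mem_suc.symm, fun h => h ▸ fun _ => mem_suc⟩

theorem upair_inj {x y x' y' : M} (h : upair x y = upair x' y') :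
    x = x' ∧ y = y' ∨ x = y' ∧ y = x' := by
  have h1 : ∀ z, (z = x ∨ z = y) ↔ (z = x' ∨ z = y') := fun z => by
    rw [← mem_upair, h, mem_upair]
  have := h1 x; have := h1 y; have := h1 x'; have := h1 y'
  grind

theorem pair_inj {x y x' y' : M} : pair x y = pair x' y' ↔ x = x' ∧ y = y' := by
  refine ⟨fun h => ?_, fun h => by rw [h.1, h.2]⟩
  rcases upair_inj h with ⟨h1, h2⟩ | ⟨h1, h2⟩
  · have h1 := upair_inj h1
    have h2 := upair_inj h2
    grind
  · have h1 := upair_inj h1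
    have h2 := upair_inj h2
    grind

theorem Subset.antisymm {x y : M} (h : Subset x y) (h' : Subset y x) : x = y :=
  eq_of_mem_iff fun z => ⟨h z, h' z⟩

theorem not_mem_self (x : M) : ¬x ε x := by
  intro h
  obtain ⟨y, hy, hy'⟩ := exists_min (upair x x) ⟨x, by simp⟩
  simp only [mem_upair, or_self] at hy hy'
  subst hy
  exact hy' _ h rfl

/-! ### Functions -/

theorem app_iff_mem {f x y : M} : App f x y ↔ pair x y ε f := by
  simp [App, isPair_iff]

theorem IsFunOn.app_iff {f d x y : M} (h : IsFunOn f d) : App f x y ↔ x ε d ∧ y = ap f x := by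
  have key : ∀ x, x ε d → ∀ y, App f x y ↔ y = ap f x := by
    intro x hx
    obtain ⟨y, hy, hu⟩ := h.2 x hx
    have : y = ap f x := eq_of_mem_iff fun z => by
      rw [ap, mem_mk]
      · exact ⟨fun hz => ⟨y, hy, hz⟩, fun ⟨y', h1, h2⟩ => hu y' h1 ▸ h2⟩
      · exact ⟨y, fun z => ⟨fun hz => ⟨y, hy, hz⟩, fun ⟨y', h1, h2⟩ => hu y' h1 ▸ h2⟩⟩
    exact fun z => ⟨fun hz => (hu z hz).trans this, fun e => by rw [e, ← this]; exact hy⟩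
  refine ⟨fun hxy => ?_, fun ⟨h1, h2⟩ => (key x h1 y).2 h2⟩
  obtain ⟨p, hp, e⟩ := hxy
  obtain ⟨x', hx', y', e'⟩ := h.1 p hp
  rw [isPair_iff] at e e'
  obtain ⟨rfl, rfl⟩ := pair_inj.1 (e ▸ e')
  exact ⟨hx', (key x hx' y).1 ⟨p, hp, isPair_iff.2 e⟩⟩

theorem IsFunOn.ext {f g d : M} (hf : IsFunOn f d) (hg : IsFunOn g d)
    (h : ∀ x, x ε d → ap f x = ap g x) : f = g := by
  have : ∀ {f g : M}, IsFunOn f d → IsFunOn g d → (∀ x, x ε d → ap f x = ap g x) →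
      Subset f g := by
    intro f g hf hg h p hp
    obtain ⟨x, hx, y, e⟩ := hf.1 p hp
    rw [isPair_iff] at e
    subst e
    have := hf.app_iff.1 (app_iff_mem.2 hp)
    exact app_iff_mem.1 (hg.app_iff.2 ⟨hx, this.2.trans (h x hx)⟩)
  exact (this hf hg h).antisymm (this hg hf fun x hx => (h x hx).symm)

theorem isFun_iff {f d c : M} : IsFun f d c ↔ IsFunOn f d ∧ ∀ x, x ε d → ap f x ε c := by
  refine and_congr_right fun h => ⟨fun h' x hx => h' x _ (h.app_iff.2 ⟨hx, rfl⟩),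
    fun h' x y hxy => ?_⟩
  obtain ⟨h1, rfl⟩ := h.app_iff.1 hxy
  exact h' x h1

theorem IsFun.ap_mem {f d c x : M} (h : IsFun f d c) (hx : x ε d) : ap f x ε c :=
  (isFun_iff.1 h).2 x hx

theorem mem_lam {d p : M} {F : M → M} [hF : DfnF Set.univ fun v => F (v 0)] :
    p ε lam d F ↔ ∃ x, x ε d ∧ p = pair x (F x) :=
  mem_img

theorem app_lam_iff {d x y : M} {F : M → M} [hF : DfnF Set.univ fun v => F (v 0)] :
    App (lam d F) x y ↔ x ε d ∧ y = F x := by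
  rw [app_iff_mem, mem_lam]
  simp only [pair_inj]
  grind

theorem isFunOn_lam (d : M) (F : M → M) [hF : DfnF Set.univ fun v => F (v 0)] :
    IsFunOn (lam d F) d := by
  refine ⟨fun p hp => ?_, fun x hx => ⟨F x, app_lam_iff.2 ⟨hx, rfl⟩,
    fun z hz => (app_lam_iff.1 hz).2⟩⟩
  obtain ⟨x, hx, rfl⟩ := mem_lam.1 hp
  exact ⟨x, hx, F x, isPair_iff.2 rfl⟩

theorem ap_lam {d x : M} {F : M → M} [hF : DfnF Set.univ fun v => F (v 0)] (hx : x ε d) :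
    ap (lam d F) x = F x :=
  (app_lam_iff.1 ((isFunOn_lam d F).app_iff.2 ⟨hx, rfl⟩)).2

theorem isFun_lam {d c : M} {F : M → M} [hF : DfnF Set.univ fun v => F (v 0)]
    (h : ∀ x, x ε d → F x ε c) : IsFun (lam d F) d c :=
  isFun_iff.2 ⟨isFunOn_lam d F, fun x hx => by rw [ap_lam hx]; exact h x hx⟩

theorem lam_congr {d : M} {F G : M → M} (h : ∀ x, x ε d → F x = G x) : lam d F = lam d G := by
  unfold lam img
  congr 1
  ext p
  exact exists_congr fun x => and_congr_right fun hx => by simp only [h x hx]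

theorem mem_funs {f d c : M} : f ε funs d c ↔ IsFun f d c := by
  -- With `U = d ∪ c`, a Kuratowski pair from `U` lies in `pow (pow U)`, so a function from `d` to
  -- `c` lies in `pow (pow (pow U))`.
  refine mem_mk ⟨sep (pow (pow (pow (sUn (upair d c))))) fun f => IsFun f d c, fun f => ?_⟩ f
  rw [mem_sep, and_iff_right_of_imp]
  intro h
  simp only [mem_pow]
  intro p hp
  obtain ⟨x, hx, y, e⟩ := h.1.1 p hp
  rw [isPair_iff] at e
  subst e
  have hy := h.2 x y (app_iff_mem.2 hp)
  simp only [mem_pow]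
  intro q hq
  rw [mem_pow]
  intro z hz
  simp only [pair, mem_upair] at hq
  rcases hq with rfl | rfl <;> simp only [mem_upair, or_self] at hz <;> grind [mem_sUn, mem_upair]

theorem IsFunOn.agreeOff_iff {w s t i : M} (hs : IsFunOn s w) (ht : IsFunOn t w) :
    AgreeOff w s t i ↔ ∀ j, j ε w → j ≠ i → ap s j = ap t j := by
  refine forall_congr' fun j => forall_congr' fun hj => forall_congr' fun _ => ?_
  simp only [hs.app_iff, ht.app_iff, hj, true_and]
  exact ⟨fun h => (h _).1 rfl, fun h y => by rw [h]⟩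

/-! ### Ordinals -/

theorem IsOrd.mem {α β : M} (h : IsOrd α) (hβ : β ε α) : IsOrd β :=
  ⟨h.2 β hβ, fun γ hγ => h.2 γ (h.1 β hβ γ hγ)⟩

theorem IsOrd.trans {α β γ : M} (h : IsOrd α) (hβ : β ε α) (hγ : γ ε β) : γ ε α :=
  h.1 β hβ γ hγ

theorem IsOrd.exists_least {P : M → Prop} [hP : Dfn Set.univ fun v => P (v 0)] {α : M}
    (hα : IsOrd α) (h : P α) : ∃ β, IsLeast' P β := by
  obtain ⟨β, hβ, hmin⟩ := exists_min (sep (suc α) P) ⟨α, mem_sep.2 ⟨by simp, h⟩⟩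
  rw [mem_sep, mem_suc] at hβ
  have hβo : IsOrd β := hβ.1.elim hα.mem fun e => e ▸ hα
  refine ⟨β, hβo, hβ.2, fun γ hγ hPγ => hmin γ hγ (mem_sep.2 ⟨mem_suc.2 (.inl ?_), hPγ⟩)⟩
  rcases hβ.1 with h | rfl
  · exact hα.trans h hγ
  · exact hγ

theorem ord_induction {P : M → Prop} [hP : Dfn Set.univ fun v => P (v 0)]
    (ih : ∀ α, IsOrd α → (∀ β, β ε α → P β) → P α) {α : M} (hα : IsOrd α) : P α := by
  by_contra h
  obtain ⟨β, h1, h2, h3⟩ := hα.exists_least (P := fun x => ¬P x) h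
  exact h2 (ih β h1 fun γ hγ => not_not.1 (h3 γ hγ))

theorem IsOrd.trichotomy {α β : M} (hα : IsOrd α) (hβ : IsOrd β) : α ε β ∨ α = β ∨ β ε α := by
  refine ord_induction (P := fun α => ∀ β, IsOrd β → α ε β ∨ α = β ∨ β ε α) ?_ hα β hβ
  clear hα hβ α β
  intro α hα ih β hβ
  refine ord_induction (P := fun β => α ε β ∨ α = β ∨ β ε α) ?_ hβ
  intro β hβ ih'
  by_contra! h
  refine h.2.1 (Subset.antisymm (fun x hx => ?_) fun y hy => ?_)
  · rcases ih x hx β hβ with h1 | rfl | h1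
    · exact h1
    · exact (h.2.2 hx).elim
    · exact (h.2.2 (hα.trans hx h1)).elim
  · rcases ih' y hy with h1 | rfl | h1
    · exact (h.1 (hβ.trans hy h1)).elim
    · exact (h.1 hy).elim
    · exact h1

theorem IsLeast'.unique {P : M → Prop} {α β : M} (hα : IsLeast' P α) (hβ : IsLeast' P β) :
    α = β := by
  rcases hα.1.trichotomy hβ.1 with h | h | h
  · exact (hβ.2.2 _ h hα.2.1).elim
  · exact h
  · exact (hα.2.2 _ h hβ.2.1).elim

theorem isLeast_least {P : M → Prop} [hP : Dfn Set.univ fun v => P (v 0)] {α : M}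
    (hα : IsOrd α) (h : P α) : IsLeast' P (least P) := by
  obtain ⟨β, hβ⟩ := hα.exists_least h
  have key : ∀ z, z ε β ↔ ∃ α, IsLeast' P α ∧ z ε α :=
    fun z => ⟨fun hz => ⟨β, hβ, hz⟩, fun ⟨γ, h1, h2⟩ => h1.unique hβ ▸ h2⟩
  have : β = least P := eq_of_mem_iff fun z => (key z).trans (mem_mk ⟨β, key⟩ z).symm
  exact this ▸ hβ

theorem isOrd_emp : IsOrd (emp M) :=
  ⟨fun y hy => (not_mem_emp y hy).elim, fun y hy => (not_mem_emp y hy).elim⟩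

theorem IsOrd.suc {α : M} (h : IsOrd α) : IsOrd (suc α) := by
  have : ∀ y, y ε SetTheoryLogic.suc α → IsOrd y ∧ Subset y α := fun y hy => by
    rcases mem_suc.1 hy with h1 | rfl
    · exact ⟨h.mem h1, h.1 y h1⟩
    · exact ⟨h, fun _ => id⟩
  exact ⟨fun y hy z hz => mem_suc.2 (.inl ((this y hy).2 z hz)), fun y hy => (this y hy).1.1⟩

theorem isOrd_sUn {a : M} (h : ∀ x, x ε a → IsOrd x) : IsOrd (sUn a) := by
  refine ⟨fun y hy z hz => ?_, fun y hy => ?_⟩ <;> obtain ⟨x, hx, hy⟩ := mem_sUn.1 hy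
  · exact mem_sUn.2 ⟨x, hx, (h x hx).trans hy hz⟩
  · exact ((h x hx).mem hy).1

/-- Every set of ordinals has a strict upper bound. -/
theorem exists_ord_bound (a : M) : ∃ δ, IsOrd δ ∧ ∀ x, x ε a → IsOrd x → x ε δ := by
  have h : ∀ x, x ε sep a IsOrd → IsOrd x := fun x hx => (mem_sep.1 hx).2
  refine ⟨suc (sUn (sep a IsOrd)), (isOrd_sUn h).suc, fun x hx hxo => ?_⟩
  rcases hxo.trichotomy (isOrd_sUn h).suc with h1 | h1 | h1
  · exact h1
  all_goals
    have h2 : sUn (sep a IsOrd) ε x := by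
      first
      | exact h1 ▸ mem_suc.2 (.inr rfl)
      | exact hxo.trans h1 (mem_suc.2 (.inr rfl))
    exact (not_mem_self _ (mem_sUn.2 ⟨x, mem_sep.2 ⟨hx, hxo⟩, h2⟩)).elim

theorem IsOrd.subset_iff {α β : M} (hα : IsOrd α) (hβ : IsOrd β) :
    Subset α β ↔ α ε β ∨ α = β := by
  refine ⟨fun h => ?_, fun h => h.elim (hβ.1 α) fun e => e ▸ fun _ => id⟩
  rcases hα.trichotomy hβ with h1 | h1 | h1
  · exact .inl h1
  · exact .inr h1
  · exact (not_mem_self _ (h _ h1)).elim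

theorem IsOrd.mem_of_subset_of_mem {α β γ : M} (hα : IsOrd α) (hγ : IsOrd γ)
    (h : Subset α β) (hβ : β ε γ) : α ε γ := by
  rcases (hα.subset_iff (hγ.mem hβ)).1 h with h | rfl
  · exact hγ.trans hβ h
  · exact hβ

/-! ### Natural numbers -/

theorem isInd_iff {x : M} : IsInd x ↔ emp M ε x ∧ ∀ y, y ε x → suc y ε x := by
  simp [IsInd, isEmp_iff, isSucc_iff]

variable (M) in
theorem exists_isOmega : ∃ w : M, IsOmega w := by
  obtain ⟨x, hx⟩ := exists_isInd M
  refine ⟨sep x fun y => ∀ z, IsInd z → y ε z, isInd_iff.2 ⟨?_, ?_⟩, ?_⟩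
  · exact mem_sep.2 ⟨(isInd_iff.1 hx).1, fun z hz => (isInd_iff.1 hz).1⟩
  · intro y hy
    rw [mem_sep] at hy ⊢
    exact ⟨(isInd_iff.1 hx).2 y hy.1, fun z hz => (isInd_iff.1 hz).2 y (hy.2 z hz)⟩
  · exact fun z hz y hy => (mem_sep.1 hy).2 z hz

theorem isOmega_iff {w : M} : IsOmega w ↔ w = omega M := by
  have hu : ∀ w w' : M, IsOmega w → IsOmega w' → w = w' := fun w w' h h' =>
    Subset.antisymm (h.2 w' h'.1) (h'.2 w h.1)
  obtain ⟨w', hw'⟩ := exists_isOmega M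
  have key : ∀ z, z ε w' ↔ ∃ w, IsOmega w ∧ z ε w :=
    fun z => ⟨fun hz => ⟨w', hw', hz⟩, fun ⟨γ, h1, h2⟩ => hu _ _ h1 hw' ▸ h2⟩
  have : w' = omega M := eq_of_mem_iff fun z => (key z).trans (mem_mk ⟨w', key⟩ z).symm
  exact ⟨fun h => this ▸ hu _ _ h hw', fun h => h ▸ this ▸ hw'⟩

theorem isInd_omega : IsInd (omega M) := (isOmega_iff.2 rfl).1

theorem emp_mem_omega : emp M ε omega M := (isInd_iff.1 isInd_omega).1

theorem suc_mem_omega {n : M} (h : n ε omega M) : suc n ε omega M :=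
  (isInd_iff.1 isInd_omega).2 n h

theorem omega_induction {P : M → Prop} [hP : Dfn Set.univ fun v => P (v 0)] (h0 : P (emp M))
    (hs : ∀ n, n ε omega M → P n → P (suc n)) {n : M} (hn : n ε omega M) : P n := by
  refine (mem_sep.1 ((isOmega_iff.2 rfl : IsOmega (omega M)).2 (sep (omega M) P)
    (isInd_iff.2 ⟨mem_sep.2 ⟨emp_mem_omega, h0⟩, fun y hy => ?_⟩) n hn)).2
  rw [mem_sep] at hy ⊢
  exact ⟨suc_mem_omega hy.1, hs y hy.1 hy.2⟩

theorem isOrd_omega : IsOrd (omega M) := by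
  refine ⟨fun n hn => ?_, fun n hn => ?_⟩
  · refine omega_induction (P := fun n => Subset n (omega M)) ?_ ?_ hn
    · exact fun x hx => (not_mem_emp x hx).elim
    · intro n hn ih x hx
      rcases mem_suc.1 hx with h | rfl
      exacts [ih x h, hn]
  · exact (omega_induction (P := IsOrd) isOrd_emp (fun n _ h => h.suc) hn).1

/-- The standard natural numbers. -/
noncomputable def num : ℕ → M
  | 0 => emp M
  | n + 1 => suc (num n)

instance (n : ℕ) : DfnC C (num n : M) := by
  induction n with
  | zero => exact inferInstanceAs (DfnC C (emp M))
  | succ n ih =>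
    exact ⟨inferInstanceAs (DfnF C fun _ => suc (num n))⟩

theorem num_mem_omega (n : ℕ) : num n ε omega M := by
  induction n with
  | zero => exact emp_mem_omega
  | succ n ih => exact suc_mem_omega ih

theorem num_mem_num {m n : ℕ} (h : m < n) : (num m : M) ε num n := by
  induction n with
  | zero => omega
  | succ n ih =>
    refine mem_suc.2 ?_
    rcases Nat.lt_succ_iff_lt_or_eq.1 h with h | rfl
    exacts [.inl (ih h), .inr rfl]

theorem num_injective : Function.Injective (num : ℕ → M) := by
  intro m n h
  by_contra hne
  rcases Nat.lt_or_gt_of_ne hne with h1 | h1 <;> have := num_mem_num (M := M) h1 <;> rw [h] at this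
  all_goals exact not_mem_self _ this

/-! ### Recursion on the ordinals -/

def IsApprox (G : M → M → M) (p α f : M) : Prop :=
  IsFunOn f α ∧ ∀ β, β ε α → ap f β = G p (lam β fun x => ap f x)

/-- The function `F` on the ordinals that satisfies `F α = G p (F ↾ α)`. -/
noncomputable def ordRec (G : M → M → M) (p α : M) : M :=
  mk fun z => ∃ f, IsApprox G p α f ∧ z ε G p f

variable (G : M → M → M)

instance dfn_isApprox [hG : DfnF C fun v => G (v 0) (v 1)] (f g h : (ℕ → M) → M)
    [DfnF C f] [DfnF C g] [DfnF C h] : Dfn C fun v => IsApprox G (f v) (g v) (h v) := by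
  have := @DfnF.comp₂ _ _ _ _ _ G hG
  unfold IsApprox
  infer_instance

instance dfnF_ordRec [hG : DfnF C fun v => G (v 0) (v 1)] (f g : (ℕ → M) → M)
    [DfnF C f] [DfnF C g] : DfnF C fun v => ordRec G (f v) (g v) := by
  have := @DfnF.comp₂ _ _ _ _ _ G hG
  unfold ordRec
  infer_instance

variable [hG : DfnF Set.univ fun v => G (v 0) (v 1)]

theorem IsApprox.eq {p α f g : M} (hα : IsOrd α) (hf : IsApprox G p α f)
    (hg : IsApprox G p α g) : f = g := by
  refine hf.1.ext hg.1 fun x hx => ?_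
  refine ord_induction (P := fun x => x ε α → ap f x = ap g x) ?_ (hα.mem hx) hx
  intro x _ ih hx
  rw [hf.2 x hx, hg.2 x hx, lam_congr fun y hy => ih y hy (hα.trans hx hy)]

theorem IsApprox.ordRec_eq {p α f : M} (hα : IsOrd α) (hf : IsApprox G p α f) :
    ordRec G p α = G p f := by
  have h : ∀ z, z ε G p f ↔ ∃ f, IsApprox G p α f ∧ z ε G p f := fun z =>
    ⟨fun hz => ⟨f, hf, hz⟩, fun ⟨g, hg, hz⟩ => by rwa [hf.eq G hα hg]⟩
  exact eq_of_mem_iff fun z => (mem_mk ⟨_, h⟩ z).trans (h z).symm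

/-- By induction on `α`: the value at `β ε α` is computed from the approximation on `β`, which is
the restriction of `ordRec G p` to `β`. -/
theorem isApprox_lam (p : M) {α : M} (hα : IsOrd α) : IsApprox G p α (lam α (ordRec G p)) := by
  refine ord_induction (P := fun α => IsApprox G p α (lam α (ordRec G p))) ?_ hα
  intro α hα ih
  refine ⟨isFunOn_lam _ _, fun β hβ => ?_⟩
  rw [ap_lam hβ, (ih β hβ).ordRec_eq G (hα.mem hβ)]
  congr 1
  exact lam_congr fun γ hγ => (ap_lam (hα.trans hβ hγ)).symm

theorem ordRec_eq (p : M) {α : M} (hα : IsOrd α) :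
    ordRec G p α = G p (lam α (ordRec G p)) :=
  (isApprox_lam G p hα).ordRec_eq G hα

end Operations

/-! ### Levels `V α`, `∈`-induction and closure ordinals. -/

section Hierarchy

set_option linter.unusedSectionVars false

universe w
variable {M : Type w} [LSet.Structure M] {C : Set M} [Nonempty M]

/-! ### The cumulative hierarchy -/

noncomputable def vStep (g : M) : M := mk fun x => ∃ γ B, App g γ B ∧ Subset x B

/-- The level `V_α` of the cumulative hierarchy. -/
noncomputable def V (α : M) : M := ordRec (fun _ g => vStep g) (emp M) α

noncomputable def upd (w s i x : M) : M := lam w fun j => pick (j = i) x (ap s j)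

/-- The step of the recursion that generates a transitive set that includes `x`. -/
noncomputable def tcStep (x g : M) : M :=
  mk fun z => z ε x ∨ ∃ γ B, App g γ B ∧ ∃ y, y ε B ∧ z ε y

variable [hZF : M ⊨ ZF]

instance (f : (ℕ → M) → M) [DfnF C f] : DfnF C fun v => vStep (f v) := by
  unfold vStep; infer_instance

instance (f : (ℕ → M) → M) [DfnF C f] : DfnF C fun v => V (f v) := by
  unfold V; infer_instance

instance (f g : (ℕ → M) → M) [DfnF C f] [DfnF C g] : DfnF C fun v => tcStep (f v) (g v) := by
  unfold tcStep; infer_instance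

theorem mem_vStep_lam {α x : M} (F : M → M) [hF : DfnF Set.univ fun v => F (v 0)] :
    x ε vStep (lam α F) ↔ ∃ γ, γ ε α ∧ Subset x (F γ) := by
  have := DfnF.comp₁ F (hF := hF)
  simp only [vStep, app_lam_iff]
  rw [mem_mk]
  · grind
  · refine ⟨sUn (img α fun γ => pow (F γ)), fun x => ?_⟩
    simp only [mem_sUn, mem_img]
    constructor
    · rintro ⟨_, ⟨γ, hγ, rfl⟩, h⟩
      exact ⟨γ, _, ⟨hγ, rfl⟩, mem_pow.1 h⟩
    · rintro ⟨γ, _, ⟨hγ, rfl⟩, h⟩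
      exact ⟨_, ⟨γ, hγ, rfl⟩, mem_pow.2 h⟩

theorem mem_V {α x : M} (hα : IsOrd α) : x ε V α ↔ ∃ γ, γ ε α ∧ Subset x (V γ) := by
  unfold V
  rw [ordRec_eq _ _ hα, mem_vStep_lam]

theorem V_mono {α β : M} (hα : IsOrd α) (h : β ε α) : Subset (V β) (V α) := by
  intro x hx
  obtain ⟨γ, hγ, hx⟩ := (mem_V (hα.mem h)).1 hx
  exact (mem_V hα).2 ⟨γ, hα.trans h hγ, hx⟩

theorem subset_V {α : M} (hα : IsOrd α) : Subset α (V α) :=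
  ord_induction (P := fun α => Subset α (V α))
    (fun _ hα ih β hβ => (mem_V hα).2 ⟨β, hβ, ih β hβ⟩) hα

theorem isV_iff {θ A : M} : IsV θ A ↔ IsOrd θ ∧ A = V θ := by
  refine and_congr_right fun hθ => ?_
  simp only [isSucc_iff, exists_eq_left]
  constructor
  · rintro ⟨f, ⟨hf, h⟩, hA⟩
    have key : ∀ {β : M}, IsOrd β → β ε suc θ → ap f β = V β := by
      intro β hβ
      refine ord_induction (P := fun β => β ε suc θ → ap f β = V β) ?_ hβ
      intro β hβ ih hβθ
      refine eq_of_mem_iff fun x => ?_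
      rw [h β hβθ _ (hf.app_iff.2 ⟨hβθ, rfl⟩), mem_V hβ]
      refine exists_congr fun γ => and_congr_right fun hγ => ?_
      have hγθ := hθ.suc.trans hβθ hγ
      simp only [hf.app_iff, hγθ, true_and, exists_eq_left, ih γ hγ hγθ]
    obtain ⟨h1, rfl⟩ := hf.app_iff.1 hA
    exact key hθ h1
  · rintro rfl
    refine ⟨lam (suc θ) V, ⟨isFunOn_lam _ _, ?_⟩, app_lam_iff.2 ⟨mem_suc.2 (.inr rfl), rfl⟩⟩
    intro β hβ B hB x
    rw [app_lam_iff] at hB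
    rw [hB.2, mem_V (hθ.suc.mem hβ)]
    refine exists_congr fun γ => and_congr_right fun hγ => ?_
    simp [app_lam_iff, hθ.suc.trans hβ hγ]

/-- Adjoin to `x` the elements of elements of earlier stages and iterate. The stage `ω` is
transitive because an element of it appears before some `γ ε ω`, and `suc γ ε ω`. -/
theorem exists_isTrans (x : M) : ∃ t : M, IsTrans t ∧ Subset x t := by
  have hstep : ∀ {α z : M}, IsOrd α → (z ε ordRec tcStep x α ↔
      z ε x ∨ ∃ γ, γ ε α ∧ ∃ y, y ε ordRec tcStep x γ ∧ z ε y) := by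
    intro α z hα
    rw [ordRec_eq _ _ hα]
    nth_rewrite 1 [tcStep]
    simp only [app_lam_iff]
    rw [mem_mk]
    · grind
    · refine ⟨sUn (upair x (sUn (img α fun γ => sUn (ordRec tcStep x γ)))), fun z => ?_⟩
      simp only [mem_sUn, mem_upair]
      constructor
      · rintro ⟨_, rfl | rfl, h⟩
        · exact .inl h
        · obtain ⟨_, hy, h⟩ := mem_sUn.1 h
          obtain ⟨γ, hγ, rfl⟩ := mem_img.1 hy
          exact .inr ⟨γ, _, ⟨hγ, rfl⟩, mem_sUn.1 h⟩
      · rintro (h | ⟨γ, _, ⟨hγ, rfl⟩, h⟩)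
        · exact ⟨x, .inl rfl, h⟩
        · exact ⟨_, .inr rfl, mem_sUn.2 ⟨_, mem_img.2 ⟨γ, hγ, rfl⟩, mem_sUn.2 h⟩⟩
  refine ⟨ordRec tcStep x (omega M), fun z hz u hu => (hstep isOrd_omega).2 (.inr ?_),
    fun z hz => (hstep isOrd_omega).2 (.inl hz)⟩
  rcases (hstep isOrd_omega).1 hz with h | ⟨γ, hγ, h⟩
  · exact ⟨emp M, emp_mem_omega, z, (hstep isOrd_emp).2 (.inl h), hu⟩
  · exact ⟨suc γ, suc_mem_omega hγ, z, (hstep (isOrd_omega.mem hγ).suc).2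
      (.inr ⟨γ, mem_suc.2 (.inr rfl), h⟩), hu⟩

/-- Foundation speaks only of sets, so a minimal counterexample is taken inside a transitive set
containing `x`. -/
theorem mem_induction {P : M → Prop} [hP : Dfn Set.univ fun v => P (v 0)]
    (ih : ∀ x, (∀ y, y ε x → P y) → P x) (x : M) : P x := by
  by_contra hx
  obtain ⟨t, ht, hxt⟩ := exists_isTrans (upair x x)
  obtain ⟨y, hy, hmin⟩ := exists_min (sep t fun x => ¬P x)
    ⟨x, mem_sep.2 ⟨hxt x (mem_upair.2 (.inl rfl)), hx⟩⟩
  rw [mem_sep] at hy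
  refine hy.2 (ih y fun z hz => ?_)
  by_contra hPz
  exact hmin z hz (mem_sep.2 ⟨ht y hy.1 z hz, hPz⟩)

/-- An ordinal bound for the least ordinals that have a property which depends on an element
of a set. -/
theorem exists_collection (a : M) (P : M → M → Prop) [hP : Dfn Set.univ fun v => P (v 0) (v 1)]
    (h : ∀ x, x ε a → ∃ β, IsOrd β ∧ P x β) :
    ∃ δ, IsOrd δ ∧ ∀ x, x ε a → ∃ β, β ε δ ∧ P x β := by
  have : Dfn Set.univ fun v => P (v 1) (v 0) := hP.subst fun n => Nat.casesOn n 1 fun _ => 0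
  have : ∀ x : M, Dfn Set.univ fun v => P x (v 0) := fun x =>
    Dfn.section (P := fun v y => P (v 0) y) this fun _ => x
  have : DfnF Set.univ fun v => least fun β => P (v 0) β := inferInstance
  obtain ⟨δ, hδ, hb⟩ := exists_ord_bound (img a fun x => least fun β => P x β)
  refine ⟨δ, hδ, fun x hx => ?_⟩
  obtain ⟨β, hβ, hx'⟩ := h x hx
  have hl := isLeast_least (P := fun β => P x β) hβ hx'
  exact ⟨_, hb _ (mem_img.2 ⟨x, hx, rfl⟩) hl.1, hl.2.1⟩

theorem exists_mem_V (x : M) : ∃ α, IsOrd α ∧ x ε V α := by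
  refine mem_induction (P := fun x => ∃ α, IsOrd α ∧ x ε V α) (fun x ih => ?_) x
  obtain ⟨δ, hδ, h⟩ := exists_collection x (fun y α => y ε V α) ih
  refine ⟨suc δ, hδ.suc, (mem_V hδ.suc).2 ⟨δ, mem_suc.2 (.inr rfl), fun y hy => ?_⟩⟩
  obtain ⟨β, hβ, hy⟩ := h y hy
  exact V_mono hδ hβ y hy

theorem upd_same {w s i x : M} (hi : i ε w) : ap (upd w s i x) i = x := by
  rw [upd, ap_lam hi, pick, if_pos rfl]

theorem upd_other {w s i j x : M} (hj : j ε w) (h : j ≠ i) : ap (upd w s i x) j = ap s j := by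
  rw [upd, ap_lam hj, pick, if_neg h]

theorem IsFun.upd {w s c i x : M} (hs : IsFun s w c) (hi : i ε w) (hx : x ε c) :
    IsFun (upd w s i x) w c := by
  refine isFun_iff.2 ⟨isFunOn_lam _ _, fun j hj => ?_⟩
  by_cases h : j = i
  · subst h
    rwa [upd_same hj]
  · rw [upd_other hj h]
    exact hs.ap_mem hj

theorem IsFunOn.agreeOff_upd {w s i x : M} (hs : IsFunOn s w) :
    AgreeOff w s (SetTheoryLogic.upd w s i x) i :=
  (hs.agreeOff_iff (isFunOn_lam _ _)).2 fun _ hj h => (upd_other hj h).symm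

/-! ### Reflection -/

/-- The ordinals below `θ` that are the left member of a pair of ordinals below `θ` that
satisfies `K` are unbounded in `θ`. -/
def IsClosedUnder (K : M → M → Prop) (θ : M) : Prop :=
  IsOrd θ ∧ ∀ γ, γ ε θ → ∃ γ', γ' ε θ ∧ γ ε γ' ∧ ∃ β, β ε θ ∧ K γ' β

/-- One step of a closing-off sequence: beyond `p` and all earlier values, and a `K`-witness for
each of them. -/
noncomputable def closureStep (K : M → M → Prop) (p g : M) : M :=
  least fun β => p ε β ∧ ∀ γ B, App g γ B → B ε β ∧ K B β

theorem exists_isClosedUnder (K : M → M → Prop) [hK : Dfn Set.univ fun v => K (v 0) (v 1)]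
    (hmono : ∀ γ β β', K γ β → IsOrd β' → β ε β' → K γ β')
    (htot : ∀ γ, IsOrd γ → ∃ β, IsOrd β ∧ K γ β) {p : M} (hp : IsOrd p) :
    ∃ θ, IsClosedUnder K θ ∧ p ε θ := by
  have h1 := @Dfn.comp_rel _ _ _ _ _ K hK
  have h2 : DfnF Set.univ fun v => closureStep K (v 0) (v 1) := by
    unfold closureStep; infer_instance
  have hF : ∀ {α}, IsOrd α → IsLeast' (fun β => p ε β ∧ ∀ γ, γ ε α →
      ordRec (closureStep K) p γ ε β ∧ K (ordRec (closureStep K) p γ) β)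
        (ordRec (closureStep K) p α) := by
    intro α hα
    refine ord_induction (P := fun α => IsLeast' (fun β => p ε β ∧ ∀ γ, γ ε α →
      ordRec (closureStep K) p γ ε β ∧ K (ordRec (closureStep K) p γ) β)
        (ordRec (closureStep K) p α)) ?_ hα
    intro α hα ih
    have h3 : ∀ β, (p ε β ∧ ∀ γ B, App (lam α (ordRec (closureStep K) p)) γ B → B ε β ∧ K B β) ↔
        (p ε β ∧ ∀ γ, γ ε α →
      ordRec (closureStep K) p γ ε β ∧ K (ordRec (closureStep K) p γ) β) := fun β => by
      simp only [app_lam_iff]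
      grind
    rw [ordRec_eq _ _ hα]
    simp only [closureStep, h3]
    obtain ⟨β, hβ⟩ : ∃ β, IsOrd β ∧ p ε β ∧ ∀ γ, γ ε α →
        ordRec (closureStep K) p γ ε β ∧ K (ordRec (closureStep K) p γ) β := by
      obtain ⟨δ, hδ, h⟩ := exists_collection α (fun γ β => ordRec (closureStep K) p γ ε β ∧
        K (ordRec (closureStep K) p γ) β) fun γ hγ => by
          have ho := (ih γ hγ).1
          obtain ⟨β, hβ, hK'⟩ := htot _ ho
          obtain ⟨β', hβ', h⟩ := exists_ord_bound (upair (ordRec (closureStep K) p γ) β)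
          exact ⟨β', hβ', h _ (by simp) ho, hmono _ _ _ hK' hβ' (h _ (by simp) hβ)⟩
      obtain ⟨δ', hδ', h'⟩ := exists_ord_bound (upair p δ)
      have hδδ' := h' δ (by simp) hδ
      refine ⟨δ', hδ', h' p (by simp) hp, fun γ hγ => ?_⟩
      obtain ⟨β, hβ, h1, h2⟩ := h γ hγ
      have hβδ' := hδ'.trans hδδ' hβ
      exact ⟨hδ'.trans hβδ' h1, hmono _ _ _ h2 hδ' hβδ'⟩
    exact isLeast_least hβ.1 hβ.2
  -- `θ` is the supremum of the first `ω` values; any ordinal below `θ` is below some value, whose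
  -- `K`-witness is the next value.
  refine ⟨sUn (img (omega M) (ordRec (closureStep K) p)), ⟨isOrd_sUn fun x hx => ?_,
    fun γ hγ => ?_⟩, mem_sUn.2 ⟨_, mem_img.2 ⟨_, emp_mem_omega, rfl⟩, (hF isOrd_emp).2.1.1⟩⟩
  · obtain ⟨n, hn, rfl⟩ := mem_img.1 hx
    exact (hF (isOrd_omega.mem hn)).1
  · obtain ⟨_, hy, hγ⟩ := mem_sUn.1 hγ
    obtain ⟨n, hn, rfl⟩ := mem_img.1 hy
    have hs := suc_mem_omega hn
    have h3 := fun {n : M} (hn : n ε omega M) =>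
      (hF (isOrd_omega.mem (suc_mem_omega hn))).2.1.2 n (mem_suc.2 (.inr rfl))
    exact ⟨_, mem_sUn.2 ⟨_, mem_img.2 ⟨_, hs, rfl⟩, (h3 hn).1⟩, hγ,
      _, mem_sUn.2 ⟨_, mem_img.2 ⟨_, suc_mem_omega hs, rfl⟩, (h3 hs).1⟩, (h3 hn).2⟩

end Hierarchy

/-! ### Reflection: definable elements are ordinal definable. -/

section Reflection

set_option linter.unusedSectionVars false

universe w
variable {M : Type w} [LSet.Structure M] {C : Set M} [Nonempty M] [hZF : M ⊨ ZF]

theorem IsClosedUnder.imp {K K' : M → M → Prop} {θ : M} (h : IsClosedUnder K θ)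
    (hK : ∀ γ β, K γ β → K' γ β) : IsClosedUnder K' θ := by
  refine ⟨h.1, fun γ hγ => ?_⟩
  obtain ⟨γ', h1, h2, β, h3, h4⟩ := h.2 γ hγ
  exact ⟨γ', h1, h2, β, h3, hK _ _ h4⟩

/-- The elements of `V_θ` that are the first `n` values of an assignment all belong to some
earlier level. -/
theorem exists_level {θ s : M} (hθ : IsOrd θ) (hne : ∃ γ, γ ε θ)
    (hlim : ∀ γ, γ ε θ → ∃ γ', γ' ε θ ∧ γ ε γ') (hs : IsFun s (omega M) (V θ)) (n : ℕ) :
    ∃ γ, γ ε θ ∧ ∀ i < n, ap s (num i) ε V γ := by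
  induction n with
  | zero =>
    obtain ⟨γ, hγ⟩ := hne
    exact ⟨γ, hγ, by simp⟩
  | succ n ih =>
    obtain ⟨γ, hγ, h⟩ := ih
    obtain ⟨δ, hδ, h'⟩ := (mem_V hθ).1 (hs.ap_mem (num_mem_omega n))
    obtain ⟨δ', hδ', hδδ'⟩ := hlim δ hδ
    have hn : ap s (num n) ε V δ' := (mem_V (hθ.mem hδ')).2 ⟨δ, hδδ', h'⟩
    rcases (hθ.mem hγ).trichotomy (hθ.mem hδ') with h1 | rfl | h1
    · refine ⟨δ', hδ', fun i hi => ?_⟩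
      rcases Nat.lt_succ_iff_lt_or_eq.1 hi with hi | rfl
      exacts [V_mono (hθ.mem hδ') h1 _ (h i hi), hn]
    · refine ⟨γ, hδ', fun i hi => ?_⟩
      rcases Nat.lt_succ_iff_lt_or_eq.1 hi with hi | rfl
      exacts [h i hi, hn]
    · refine ⟨γ, hγ, fun i hi => ?_⟩
      rcases Nat.lt_succ_iff_lt_or_eq.1 hi with hi | rfl
      exacts [h i hi, V_mono (hθ.mem hγ) h1 _ hn]

/-- `K` describes sufficiently many closure conditions on `θ` for the truth set of `φ` in `V_θ` to
be internally definable over `V_θ`. -/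
structure IsReflector {n : ℕ} (φ : SetFormula n) (K : M → M → Prop) : Prop where
  dfn : Dfn Set.univ fun v => K (v 0) (v 1)
  mono : ∀ γ β β', K γ β → IsOrd β' → β ε β' → K γ β'
  total : ∀ γ, IsOrd γ → ∃ β, IsOrd β ∧ K γ β
  reflect : ∀ θ, IsClosedUnder K θ → (∃ γ, γ ε θ) → ∀ D, IsDefClosed (omega M) (V θ) D →
    ∀ R, (∀ s, s ε R ↔ IsFun s (omega M) (V θ) ∧
      φ.Realize default fun i => ap s (num i)) → R ε D

theorem isReflector_true {n : ℕ} {φ : SetFormula n} (h : ∀ θ, IsOrd θ →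
    ∀ D, IsDefClosed (omega M) (V θ) D → ∀ R, (∀ s, s ε R ↔ IsFun s (omega M) (V θ) ∧
      φ.Realize default fun i => ap s (num i)) → R ε D) : IsReflector φ fun _ _ : M => True :=
  ⟨inferInstance, fun _ _ _ _ _ _ => trivial, fun γ hγ => ⟨γ, hγ, trivial⟩,
    fun θ hθ _ => h θ hθ.1⟩

theorem IsReflector.imp {n : ℕ} {φ ψ : SetFormula n} {K K' : M → M → Prop}
    (h : IsReflector φ K) (h' : IsReflector ψ K') :
    IsReflector (φ ⟹ ψ) fun γ β => K γ β ∧ K' γ β := by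
  have := h.dfn
  have := h'.dfn
  refine ⟨inferInstance, fun γ β β' H ho hβ => ⟨h.mono _ _ _ H.1 ho hβ, h'.mono _ _ _ H.2 ho hβ⟩,
    fun γ hγ => ?_, fun θ hθ hne D hD R hR => ?_⟩
  · obtain ⟨β, hβ, hK⟩ := h.total γ hγ
    obtain ⟨β', hβ', hK'⟩ := h'.total γ hγ
    obtain ⟨δ, hδ, hb⟩ := exists_ord_bound (upair β β')
    exact ⟨δ, hδ, h.mono _ _ _ hK hδ (hb _ (by simp) hβ), h'.mono _ _ _ hK' hδ (hb _ (by simp) hβ')⟩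
  -- `φ ⟹ ψ` is obtained as `¬(φ ∧ ¬ψ)`, using the closure of `D` under complement and intersection.
  · let R₁ := sep (funs (omega M) (V θ)) fun s => φ.Realize default fun i => ap s (num i)
    let R₂ := sep (funs (omega M) (V θ)) fun s => ψ.Realize default fun i => ap s (num i)
    have h1 : R₁ ε D := h.reflect θ (hθ.imp fun _ _ H => H.1) hne D hD R₁ fun s => by
      rw [mem_sep, mem_funs]
    have h2 : R₂ ε D := h'.reflect θ (hθ.imp fun _ _ H => H.2) hne D hD R₂ fun s => by
      rw [mem_sep, mem_funs]
    have h3 := hD.2.2.1 R₂ h2 (sep (funs (omega M) (V θ)) fun s => ¬s ε R₂) fun s => by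
      rw [mem_sep, mem_funs]
    have h4 := hD.2.2.2.1 _ h1 _ h3
      (sep R₁ fun s => s ε sep (funs (omega M) (V θ)) fun s => ¬s ε R₂) fun s => by
      rw [mem_sep]
    refine hD.2.2.1 _ h4 R fun s => ?_
    rw [hR, mem_sep, mem_sep, mem_funs, mem_sep, mem_sep, mem_funs, BoundedFormula.realize_imp]
    tauto

/-- The quantifier in scope `n` binds variable `n`, so appending a value amounts to changing the
coordinate `num n`. -/
theorem realize_snoc_upd {n : ℕ} (ψ : SetFormula (n + 1)) (s x : M) :
    (ψ.Realize default fun i => ap (upd (omega M) s (num n) x) (num i)) ↔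
      ψ.Realize default (Fin.snoc (α := fun _ => M) (fun i : Fin n => ap s (num i)) x) := by
  refine iff_of_eq (congrArg _ ?_)
  ext i
  refine Fin.lastCases ?_ (fun i => ?_) i
  · simp [upd_same (num_mem_omega n)]
  · have : (num i : M) ≠ num n := fun h => i.2.ne (num_injective h)
    simp [upd_other (num_mem_omega _) this]

/-- The extra clause on `K` is a Tarski–Vaught condition: a counterexample to `ψ` for an assignment
into `V γ` can be found in `V β`. For closed `θ`, truth of the quantified formula in `M` is then
decided by projecting inside `V θ`. -/
theorem IsReflector.all {n : ℕ} {ψ : SetFormula (n + 1)} {K : M → M → Prop}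
    (h : IsReflector ψ K) :
    IsReflector (BoundedFormula.all ψ) fun γ β => K γ β ∧ ∀ s, IsFun s (omega M) (V γ) →
      (∃ x, ¬ψ.Realize default (Fin.snoc (α := fun _ => M) (fun i : Fin n => ap s (num i)) x)) →
      ∃ x, x ε V β ∧
        ¬ψ.Realize default (Fin.snoc (α := fun _ => M) (fun i : Fin n => ap s (num i)) x) := by
  have := h.dfn
  refine ⟨inferInstance, fun γ β β' H ho hβ => ⟨h.mono _ _ _ H.1 ho hβ, fun s hs hx => ?_⟩,
    fun γ hγ => ?_, fun θ hθ hne D hD R hR => ?_⟩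
  · obtain ⟨x, hx, h1⟩ := H.2 s hs hx
    exact ⟨x, V_mono ho hβ x hx, h1⟩
  · obtain ⟨β, hβ, hK⟩ := h.total γ hγ
    obtain ⟨δ, hδ, H⟩ := exists_collection (funs (omega M) (V γ)) (fun s β =>
      (∃ x, ¬ψ.Realize default (Fin.snoc (α := fun _ => M) (fun i : Fin n => ap s (num i)) x)) →
      ∃ x, x ε V β ∧
        ¬ψ.Realize default (Fin.snoc (α := fun _ => M) (fun i : Fin n => ap s (num i)) x)) (by
        intro s _
        by_cases hx : ∃ x,
          ¬ψ.Realize default (Fin.snoc (α := fun _ => M) (fun i : Fin n => ap s (num i)) x)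
        · obtain ⟨x, hx⟩ := hx
          obtain ⟨α, hα, hxα⟩ := exists_mem_V x
          exact ⟨α, hα, fun _ => ⟨x, hxα, hx⟩⟩
        · exact ⟨_, isOrd_emp, fun h => (hx h).elim⟩)
    obtain ⟨δ', hδ', hb⟩ := exists_ord_bound (upair β δ)
    refine ⟨δ', hδ', h.mono _ _ _ hK hδ' (hb _ (by simp) hβ), fun s hs hx => ?_⟩
    obtain ⟨β', hβ', H⟩ := H s (mem_funs.2 hs)
    obtain ⟨x, hx, h1⟩ := H hx
    exact ⟨x, V_mono hδ' (hδ'.trans (hb δ (by simp) hδ) hβ') x hx, h1⟩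
  · let R₁ := sep (funs (omega M) (V θ)) fun s =>
      ψ.Realize default fun i : Fin (n + 1) => ap s (num i)
    have h1 : R₁ ε D := h.reflect θ (hθ.imp fun _ _ H => H.1) hne D hD R₁ fun s => by
      rw [mem_sep, mem_funs]
    let R₂ := sep (funs (omega M) (V θ)) fun s => ¬s ε R₁
    have h2 : R₂ ε D := hD.2.2.1 R₁ h1 R₂ fun s => by rw [mem_sep, mem_funs]
    let R₃ := sep (funs (omega M) (V θ)) fun s => ∃ t, t ε R₂ ∧ AgreeOff (omega M) s t (num n)
    have h3 : R₃ ε D := hD.2.2.2.2 R₂ h2 _ (num_mem_omega n) R₃ fun s => by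
      rw [mem_sep, mem_funs]
    refine hD.2.2.1 R₃ h3 R fun s => (hR s).trans (and_congr_right fun hs => ?_)
    have key : s ε R₃ ↔ ∃ x, x ε V θ ∧
        ¬ψ.Realize default (Fin.snoc (α := fun _ => M) (fun i : Fin n => ap s (num i)) x) := by
      simp only [R₃, R₂, R₁, mem_sep, mem_funs, hs, true_and]
      constructor
      · rintro ⟨t, ⟨ht, hψ⟩, hst⟩
        refine ⟨ap t (num n), ht.ap_mem (num_mem_omega n), fun hψ' => hψ ⟨ht, ?_⟩⟩
        have : t = upd (omega M) s (num n) (ap t (num n)) := by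
          refine ht.1.ext (isFunOn_lam _ _) fun j hj => ?_
          by_cases hjn : j = num n
          · subst hjn
            exact (upd_same hj).symm
          · exact ((hs.1.agreeOff_iff ht.1).1 hst j hj hjn).symm.trans (upd_other hj hjn).symm
        rw [this]
        exact (realize_snoc_upd ψ s _).2 hψ'
      · rintro ⟨x, hx, hψ⟩
        refine ⟨upd (omega M) s (num n) x, ⟨hs.upd (num_mem_omega n) hx, fun h' => hψ ?_⟩,
          hs.1.agreeOff_upd⟩
        exact (realize_snoc_upd ψ s _).1 h'.2
    rw [key, BoundedFormula.realize_all]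
    constructor
    · rintro H ⟨x, _, hx⟩
      exact hx (H x)
    · intro H
      by_contra hcon
      obtain ⟨x, hx⟩ := not_forall.1 hcon
      obtain ⟨γ, hγ, hsγ⟩ := exists_level hθ.1 hne (fun γ hγ =>
        let ⟨γ', h1, h2, _⟩ := hθ.2 γ hγ; ⟨γ', h1, h2⟩) hs n
      obtain ⟨γ', hγ', hγγ', β, hβ, -, HK⟩ := hθ.2 γ hγ
      have hγo := hθ.1.mem hγ'
      -- The values of `s` may be cofinal in `V θ`, while `K` only handles assignments into one
      -- level. Only the first `n` values matter, so those outside `V γ'` are replaced by the empty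
      -- set.
      let s' := lam (omega M) fun k => pick (ap s k ε V γ') (ap s k) (emp M)
      have hs' : IsFun s' (omega M) (V γ') := isFun_lam fun k _ => by
        unfold pick
        split
        · assumption
        · exact (mem_V hγo).2 ⟨γ, hγγ', fun z hz => (not_mem_emp z hz).elim⟩
      have e : (fun i : Fin n => ap s' (num i)) = fun i : Fin n => ap s (num i) := by
        ext i
        rw [ap_lam (num_mem_omega _), pick, if_pos (V_mono hγo hγγ' _ (hsγ i i.2))]
      have := HK s' hs'
      rw [e] at this
      obtain ⟨y, hy, hy'⟩ := this ⟨x, hx⟩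
      exact H ⟨y, V_mono hθ.1 hβ y hy, hy'⟩

theorem exists_isReflector {n : ℕ} (φ : SetFormula n) : ∃ K : M → M → Prop, IsReflector φ K := by
  induction φ with
  | falsum =>
    refine ⟨_, isReflector_true fun θ _ D hD R hR => ?_⟩
    -- The equation of variable `0` with itself gives all assignments; its complement is the empty
    -- relation.
    let R₁ := sep (funs (omega M) (V θ)) fun s => ∃ x, App s (emp M) x ∧ App s (emp M) x
    have h1 : R₁ ε D := hD.1 _ emp_mem_omega _ emp_mem_omega R₁ fun s => by rw [mem_sep, mem_funs]
    refine hD.2.2.1 R₁ h1 R fun s => (hR s).trans (and_congr_right fun hs => ?_)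
    have : s ε R₁ := mem_sep.2 ⟨mem_funs.2 hs, _, hs.1.app_iff.2 ⟨emp_mem_omega, rfl⟩,
      hs.1.app_iff.2 ⟨emp_mem_omega, rfl⟩⟩
    simp only [this, not_true]
    rfl
  | equal t₁ t₂ =>
    obtain ⟨i, rfl⟩ := exists_term_eq_var t₁
    obtain ⟨j, rfl⟩ := exists_term_eq_var t₂
    refine ⟨_, isReflector_true fun θ _ D hD R hR => ?_⟩
    refine hD.1 (num i) (num_mem_omega _) (num j) (num_mem_omega _) R fun s =>
      (hR s).trans (and_congr_right fun hs => ?_)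
    simp only [hs.1.app_iff, num_mem_omega, true_and, exists_eq_left]
    rfl
  | rel r ts =>
    cases r
    obtain ⟨i, hi⟩ := exists_term_eq_var (ts 0)
    obtain ⟨j, hj⟩ := exists_term_eq_var (ts 1)
    refine ⟨_, isReflector_true fun θ _ D hD R hR => ?_⟩
    refine hD.2.1 (num i) (num_mem_omega _) (num j) (num_mem_omega _) R fun s =>
      (hR s).trans (and_congr_right fun hs => ?_)
    rw [realize_rel ts i j hi hj]
    simp [hs.1.app_iff, num_mem_omega]
  | imp _ _ h₁ h₂ =>
    obtain ⟨K, hK⟩ := h₁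
    obtain ⟨K', hK'⟩ := h₂
    exact ⟨_, hK.imp hK'⟩
  | all ψ ih =>
    obtain ⟨K, hK⟩ := ih
    exact ⟨_, hK.all⟩

/-- An element that is definable without parameters is ordinal definable. -/
theorem isOD_of_dfnC {a : M} (h : DfnC ∅ a) : IsOD a := by
  obtain ⟨φ₀, hφ₀⟩ := Dfn.exists_formula (P := fun x => x = a) inferInstance
  let φ : SetFormula 1 := BoundedFormula.relabel Sum.inr φ₀
  have hφ : ∀ xs : Fin 1 → M, φ.Realize default xs ↔ xs 0 = a := fun xs => by
    rw [Formula.realize_relabel_sumInr, ← hφ₀]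
    exact iff_of_eq (congrArg _ (by ext i; rw [Subsingleton.elim i 0]))
  obtain ⟨K, hK⟩ := exists_isReflector (M := M) φ
  have := hK.dfn
  obtain ⟨α, hα, haα⟩ := exists_mem_V a
  obtain ⟨θ, hθ, hαθ⟩ := exists_isClosedUnder K hK.mono hK.total hα
  have haθ := V_mono hθ.1 hαθ a haα
  have h0 : emp M ε θ := 
    isOrd_emp.mem_of_subset_of_mem hθ.1 (fun z hz => (not_mem_emp z hz).elim) hαθ
  -- No ordinal parameters are needed, so the parameter assignment is constantly `∅`, which lies
  -- below `θ`.
  refine ⟨θ, V θ, ⟨isV_iff.2 ⟨hθ.1, rfl⟩, haθ⟩, omega M, isOmega_iff.2 rfl, emp M, not_mem_emp,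
    sep (funs (omega M) (V θ)) fun s => φ.Realize default fun i => ap s (num i), ?_,
    lam (omega M) fun _ => emp M, isFun_lam fun _ _ => h0, fun x hx => ?_⟩
  · exact fun D hD => hK.reflect θ hθ ⟨_, hαθ⟩ D hD _ fun s => by rw [mem_sep, mem_funs]
  · have hs : IsFun (lam (omega M) fun _ => emp M) (omega M) (V θ) :=
      isFun_lam fun _ _ => subset_V hθ.1 _ h0
    simp only [mem_sep, mem_funs, hφ]
    constructor
    · rintro ⟨t, ⟨ht, ha⟩, -, hx⟩
      exact (ht.1.app_iff.1 hx).2.trans ha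
    · rintro rfl
      exact ⟨_, ⟨hs.upd emp_mem_omega haθ, upd_same emp_mem_omega⟩, hs.1.agreeOff_upd,
        (hs.upd emp_mem_omega haθ).1.app_iff.2 ⟨emp_mem_omega, (upd_same emp_mem_omega).symm⟩⟩

end Reflection

/-! ### Coding ordinal definable sets by pairs of ordinals. -/

section Enumeration

set_option linter.unusedSectionVars false

universe w
variable {M : Type w} [LSet.Structure M] {C : Set M} [Nonempty M]

/-- The value under the assignment `t` of a term: of the variable `i` if `i` is a natural number,
of the constant `β` otherwise. -/
noncomputable def termVal (t i β : M) : M := pick (i ε omega M) (ap t i) β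

/-- The relation over `V_p` that is obtained in one step from the relations enumerated by `g`,
by the rule with the index `(k, i, β, j, γ)`. -/
noncomputable def ruleVal (p g k i β j γ : M) : M :=
  sep (funs (omega M) (V p)) fun t =>
    (k = num 0 ∧ termVal t i β = termVal t j γ) ∨
    (k = num 1 ∧ termVal t i β ε termVal t j γ) ∨
    (k = num 2 ∧ ∃ u, u ε funs (omega M) (V p) ∧ ¬(u ε ap g β ∧ u ε ap g γ) ∧
      AgreeOff (omega M) t u i)

def IsNew (p g k i β j γ : M) : Prop :=
  (IsOrd k ∧ IsOrd i ∧ IsOrd β ∧ IsOrd j ∧ IsOrd γ) ∧ ∀ x, ¬App g x (ruleVal p g k i β j γ)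

/-- Five successive minimisations yield the lexicographically least new index without coding tuples
of ordinals by ordinals. -/
noncomputable def newIndex₁ (p g : M) : M := least fun k => ∃ i β j γ, IsNew p g k i β j γ
noncomputable def newIndex₂ (p g : M) : M :=
  least fun i => ∃ β j γ, IsNew p g (newIndex₁ p g) i β j γ
noncomputable def newIndex₃ (p g : M) : M :=
  least fun β => ∃ j γ, IsNew p g (newIndex₁ p g) (newIndex₂ p g) β j γ
noncomputable def newIndex₄ (p g : M) : M :=
  least fun j => ∃ γ, IsNew p g (newIndex₁ p g) (newIndex₂ p g) (newIndex₃ p g) j γ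
noncomputable def newIndex₅ (p g : M) : M :=
  least fun γ => IsNew p g (newIndex₁ p g) (newIndex₂ p g) (newIndex₃ p g) (newIndex₄ p g) γ

/-- The relation with the lexicographically least index that is not yet enumerated by `g`. -/
noncomputable def enumStep (p g : M) : M :=
  ruleVal p g (newIndex₁ p g) (newIndex₂ p g) (newIndex₃ p g) (newIndex₄ p g) (newIndex₅ p g)

/-- An enumeration by ordinals of the relations that are definable over `V_p` with
ordinal parameters. -/
noncomputable def enum (p α : M) : M := ordRec enumStep p α

variable [hZF : M ⊨ ZF]

section Instances

variable (f g h f₁ f₂ f₃ f₄ : (ℕ → M) → M) [DfnF C f] [DfnF C g] [DfnF C h] [DfnF C f₁]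
  [DfnF C f₂] [DfnF C f₃] [DfnF C f₄]

instance : DfnF C fun v => termVal (f v) (g v) (h v) := by unfold termVal; infer_instance

set_option synthInstance.maxHeartbeats 400000 in
set_option synthInstance.maxSize 2000 in
instance : DfnF C fun v => ruleVal (f v) (g v) (h v) (f₁ v) (f₂ v) (f₃ v) (f₄ v) := by
  unfold ruleVal; infer_instance

instance : Dfn C fun v => IsNew (f v) (g v) (h v) (f₁ v) (f₂ v) (f₃ v) (f₄ v) := by
  unfold IsNew; infer_instance

instance : DfnF C fun v => newIndex₁ (f v) (g v) := by unfold newIndex₁; infer_instance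
instance : DfnF C fun v => newIndex₂ (f v) (g v) := by unfold newIndex₂; infer_instance
instance : DfnF C fun v => newIndex₃ (f v) (g v) := by unfold newIndex₃; infer_instance
instance : DfnF C fun v => newIndex₄ (f v) (g v) := by unfold newIndex₄; infer_instance
instance : DfnF C fun v => newIndex₅ (f v) (g v) := by unfold newIndex₅; infer_instance
instance : DfnF C fun v => enumStep (f v) (g v) := by unfold enumStep; infer_instance
instance : DfnF C fun v => enum (f v) (g v) := by unfold enum; infer_instance

end Instances

theorem isNew_newIndex {p g k i β j γ : M} (h : IsNew p g k i β j γ) :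
    IsNew p g (newIndex₁ p g) (newIndex₂ p g) (newIndex₃ p g) (newIndex₄ p g)
      (newIndex₅ p g) := by
  obtain ⟨i, β, j, γ, h⟩ := (isLeast_least (P := fun k => ∃ i β j γ, IsNew p g k i β j γ)
    h.1.1 ⟨i, β, j, γ, h⟩).2.1
  obtain ⟨β, j, γ, h⟩ := (isLeast_least (P := fun i => ∃ β j γ, IsNew p g (newIndex₁ p g) i β j γ)
    h.1.2.1 ⟨β, j, γ, h⟩).2.1
  obtain ⟨j, γ, h⟩ := (isLeast_least (P := fun β => ∃ j γ, IsNew p g (newIndex₁ p g)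
    (newIndex₂ p g) β j γ) h.1.2.2.1 ⟨j, γ, h⟩).2.1
  obtain ⟨γ, h⟩ := (isLeast_least (P := fun j => ∃ γ, IsNew p g (newIndex₁ p g)
    (newIndex₂ p g) (newIndex₃ p g) j γ) h.1.2.2.2.1 ⟨γ, h⟩).2.1
  exact (isLeast_least (P := fun γ => IsNew p g (newIndex₁ p g)
    (newIndex₂ p g) (newIndex₃ p g) (newIndex₄ p g) γ) h.1.2.2.2.2 h).2.1

theorem mem_ruleVal {p g k i β j γ t : M} : t ε ruleVal p g k i β j γ ↔
    IsFun t (omega M) (V p) ∧ ((k = num 0 ∧ termVal t i β = termVal t j γ) ∨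
      (k = num 1 ∧ termVal t i β ε termVal t j γ) ∨
      (k = num 2 ∧ ∃ u, u ε funs (omega M) (V p) ∧ ¬(u ε ap g β ∧ u ε ap g γ) ∧
        AgreeOff (omega M) t u i)) := by
  rw [ruleVal, mem_sep, mem_funs]

theorem enum_eq (p : M) {α : M} (hα : IsOrd α) :
    enum p α = enumStep p (lam α fun x => enum p x) :=
  ordRec_eq _ _ hα

theorem enum_subset (p : M) {α : M} (hα : IsOrd α) : Subset (enum p α) (funs (omega M) (V p)) := by
  intro t ht
  rw [enum_eq p hα] at ht
  exact mem_funs.2 (mem_ruleVal.1 ht).1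

/-- If new relations never ran out, `enum p` would inject the ordinals into the power set of the
assignments, against replacement. -/
theorem exists_enum_stop (p : M) : ∃ α, IsOrd α ∧ ∀ k i β j γ,
    ¬IsNew p (lam α fun x => enum p x) k i β j γ := by
  by_contra! hcon
  have hne : ∀ {α β : M}, IsOrd α → β ε α → enum p β ≠ enum p α := by
    intro α β hα hβ e
    obtain ⟨k, i, b, j, c, h⟩ := hcon α hα
    refine (isNew_newIndex h).2 β (app_lam_iff.2 ⟨hβ, ?_⟩)
    rw [e, enum_eq p hα]
    rfl
  -- `δ` exceeds the least index of every relation that is enumerated, so `enum p δ` already occurs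
  -- before `δ`.
  obtain ⟨δ, hδ, hb⟩ := exists_ord_bound
    (img (pow (funs (omega M) (V p))) fun y => least fun α => enum p α = y)
  have h1 := isLeast_least (P := fun α => enum p α = enum p δ) hδ rfl
  exact hne hδ (hb _ (mem_img.2 ⟨_, mem_pow.2 (enum_subset p hδ), rfl⟩) h1.1) h1.2.1

/-- The family `D` of relations over `V_p` is closed under the rules. -/
structure IsRuleClosed (p D : M) : Prop where
  eq : ∀ i β j γ, IsOrd i → IsOrd β → IsOrd j → IsOrd γ → ∀ R,
    (∀ t, t ε R ↔ IsFun t (omega M) (V p) ∧ termVal t i β = termVal t j γ) → R ε D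
  mem : ∀ i β j γ, IsOrd i → IsOrd β → IsOrd j → IsOrd γ → ∀ R,
    (∀ t, t ε R ↔ IsFun t (omega M) (V p) ∧ termVal t i β ε termVal t j γ) → R ε D
  proj : ∀ P, P ε D → ∀ Q, Q ε D → ∀ i, IsOrd i → ∀ R,
    (∀ t, t ε R ↔ IsFun t (omega M) (V p) ∧ ∃ u, IsFun u (omega M) (V p) ∧
      ¬(u ε P ∧ u ε Q) ∧ AgreeOff (omega M) t u i) → R ε D

/-- Where the enumeration stops, every index yields a relation already listed. -/
theorem exists_isRuleClosed (p : M) :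
    ∃ α, IsOrd α ∧ IsRuleClosed p (img α fun x => enum p x) := by
  obtain ⟨α, hα, h⟩ := exists_enum_stop p
  have key : ∀ k i β j γ, IsOrd k → IsOrd i → IsOrd β → IsOrd j → IsOrd γ → ∀ R,
      (∀ t, t ε R ↔ t ε ruleVal p (lam α fun x => enum p x) k i β j γ) →
        R ε img α fun x => enum p x := by
    intro k i β j γ h1 h2 h3 h4 h5 R hR
    have := h k i β j γ
    simp only [IsNew, not_and, not_forall, not_not] at this
    obtain ⟨x, hx⟩ := this ⟨h1, h2, h3, h4, h5⟩
    rw [app_lam_iff] at hx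
    exact mem_img.2 ⟨x, hx.1, (eq_of_mem_iff hR).trans hx.2⟩
  have hnum : ∀ n : ℕ, IsOrd (num n : M) := fun n => isOrd_omega.mem (num_mem_omega n)
  have hn : ∀ {m n : ℕ}, (num m : M) = num n ↔ m = n := num_injective.eq_iff
  refine ⟨α, hα, ⟨fun i β j γ h2 h3 h4 h5 R hR => ?_,
    fun i β j γ h2 h3 h4 h5 R hR => ?_, fun P hP Q hQ i hi R hR => ?_⟩⟩
  · refine key (num 0) i β j γ (hnum _) h2 h3 h4 h5 R fun t => ?_
    rw [hR, mem_ruleVal]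
    simp [hn]
  · refine key (num 1) i β j γ (hnum _) h2 h3 h4 h5 R fun t => ?_
    rw [hR, mem_ruleVal]
    simp [hn]
  · obtain ⟨β, hβ, rfl⟩ := mem_img.1 hP
    obtain ⟨γ, hγ, rfl⟩ := mem_img.1 hQ
    -- The projection rule does not read its fourth index; `num 0` is a filler.
    refine key (num 2) i β (num 0) γ (hnum _) hi (hα.mem hβ) (hnum _) (hα.mem hγ) R fun t => ?_
    rw [hR, mem_ruleVal]
    simp [hn, mem_funs, ap_lam hβ, ap_lam hγ]

theorem IsFunOn.agreeOff_omega_iff {s t : M} (hs : IsFunOn s (omega M))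
    (ht : IsFunOn t (omega M)) : AgreeOff (omega M) s t (omega M) ↔ s = t := by
  rw [hs.agreeOff_iff ht]
  exact ⟨fun h => hs.ext ht fun x hx => h x hx fun e => not_mem_self _ (e ▸ hx),
    fun h _ _ _ => by rw [h]⟩

/-- `ω` is not an element of `ω`, so projecting along the coordinate `ω` changes nothing and the
projection rule reduces to its Boolean part. -/
theorem IsRuleClosed.nand {p D : M} (hD : IsRuleClosed p D) {P Q R : M} (hP : P ε D)
    (hQ : Q ε D) (hR : ∀ t, t ε R ↔ IsFun t (omega M) (V p) ∧ ¬(t ε P ∧ t ε Q)) : R ε D := by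
  refine hD.proj P hP Q hQ (omega M) isOrd_omega R fun t =>
    (hR t).trans (and_congr_right fun ht => ⟨fun h => ⟨t, ht, h, ?_⟩, ?_⟩)
  · exact (ht.1.agreeOff_omega_iff ht.1).2 rfl
  · rintro ⟨u, hu, h, h'⟩
    rwa [(ht.1.agreeOff_omega_iff hu.1).1 h']

/-- The assignment that agrees with `t` on `F` and with `s` off `F`. -/
noncomputable def merge (F s t : M) : M :=
  lam (omega M) fun i => pick (i ε F) (ap t i) (ap s i)

instance (f g h : (ℕ → M) → M) [DfnF C f] [DfnF C g] [DfnF C h] :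
    DfnF C fun v => merge (f v) (g v) (h v) := by unfold merge; infer_instance

theorem ap_merge {F s t i : M} (hi : i ε omega M) :
    ap (merge F s t) i = pick (i ε F) (ap t i) (ap s i) := ap_lam hi

theorem isFun_merge {F s t A : M} (hs : IsFun s (omega M) A) (ht : IsFun t (omega M) A) :
    IsFun (merge F s t) (omega M) A :=
  isFun_lam fun i hi => by
    unfold pick
    split
    exacts [ht.ap_mem hi, hs.ap_mem hi]

/-- A merged coordinate is either a variable or an ordinal constant; the index `ω`, not being a
natural number, signals a constant to `termVal`. -/
theorem exists_termVal {θ F s i : M} (hθ : IsOrd θ) (hs : IsFun s (omega M) θ)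
    (hi : i ε omega M) : ∃ j β, IsOrd j ∧ IsOrd β ∧
      ∀ t, ap (merge F s t) i = termVal t j β := by
  by_cases h : i ε F
  · refine ⟨i, emp M, isOrd_omega.mem hi, isOrd_emp, fun t => ?_⟩
    rw [ap_merge hi, termVal, pick, pick, if_pos h, if_pos hi]
  · refine ⟨omega M, ap s i, isOrd_omega, hθ.mem (hs.ap_mem hi), fun t => ?_⟩
    rw [ap_merge hi, termVal, pick, pick, if_neg h, if_neg (not_mem_self _)]

/-- The family of relations that stay in `D` when ordinals are substituted for some variables. -/
noncomputable def substFamily (θ D : M) : M :=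
  sep (pow (funs (omega M) (V θ))) fun R => ∀ s F, IsFun s (omega M) θ →
    (sep (funs (omega M) (V θ)) fun t => merge F s t ε R) ε D

theorem mem_substFamily {θ D R : M} : R ε substFamily θ D ↔
    (∀ t, t ε R → IsFun t (omega M) (V θ)) ∧ ∀ s F, IsFun s (omega M) θ →
      (sep (funs (omega M) (V θ)) fun t => merge F s t ε R) ε D := by
  rw [substFamily, mem_sep, mem_pow]
  simp only [Subset, mem_funs]

theorem mem_subst {θ F s R t : M} : (t ε sep (funs (omega M) (V θ)) fun t => merge F s t ε R) ↔
    IsFun t (omega M) (V θ) ∧ merge F s t ε R := by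
  rw [mem_sep, mem_funs]

/-- A definable relation belongs to every closed family, hence to this one, so it remains in `D`
after ordinals are substituted. The family quantifies over all `F` because projection alters the set
of unsubstituted variables. -/
theorem IsRuleClosed.isDefClosed_substFamily {θ D : M} (hθ : IsOrd θ) (hD : IsRuleClosed θ D) :
    IsDefClosed (omega M) (V θ) (substFamily θ D) := by
  have hV : ∀ {s : M}, IsFun s (omega M) θ → IsFun s (omega M) (V θ) := fun h =>
    isFun_iff.2 ⟨h.1, fun i hi => subset_V hθ _ (h.ap_mem hi)⟩
  have hcompl : ∀ {Q : M}, Q ε D → (sep (funs (omega M) (V θ)) fun t => ¬t ε Q) ε D :=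
    fun {Q} hQ => hD.nand hQ hQ fun t => by rw [mem_sep, mem_funs, and_self]
  refine ⟨fun i hi j hj R hR => ?_, fun i hi j hj R hR => ?_, fun Q hQ R hR => ?_,
    fun P hP Q hQ R hR => ?_, fun Q hQ i hi R hR => ?_⟩
  · refine mem_substFamily.2 ⟨fun t ht => ((hR t).1 ht).1, fun s F hs => ?_⟩
    obtain ⟨i', β, h1, h2, hi'⟩ := exists_termVal (F := F) hθ hs hi
    obtain ⟨j', γ, h3, h4, hj'⟩ := exists_termVal (F := F) hθ hs hj
    refine hD.eq i' β j' γ h1 h2 h3 h4 _ fun t => mem_subst.trans (and_congr_right fun ht => ?_)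
    have hm := isFun_merge (F := F) (hV hs) ht
    simp [hR, hm, hm.1.app_iff, hi, hj, hi', hj']
  · refine mem_substFamily.2 ⟨fun t ht => ((hR t).1 ht).1, fun s F hs => ?_⟩
    obtain ⟨i', β, h1, h2, hi'⟩ := exists_termVal (F := F) hθ hs hi
    obtain ⟨j', γ, h3, h4, hj'⟩ := exists_termVal (F := F) hθ hs hj
    refine hD.mem i' β j' γ h1 h2 h3 h4 _ fun t => mem_subst.trans (and_congr_right fun ht => ?_)
    have hm := isFun_merge (F := F) (hV hs) ht
    simp [hR, hm, hm.1.app_iff, hi, hj, hi', hj']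
  · rw [mem_substFamily] at hQ
    refine mem_substFamily.2 ⟨fun t ht => ((hR t).1 ht).1, fun s F hs => ?_⟩
    refine hD.nand (hQ.2 s F hs) (hQ.2 s F hs) fun t =>
      mem_subst.trans (and_congr_right fun ht => ?_)
    have hm := isFun_merge (F := F) (hV hs) ht
    simp only [hR, hm, mem_subst, ht, true_and, and_self]
  · rw [mem_substFamily] at hP hQ
    refine mem_substFamily.2 ⟨fun t ht => hP.1 t ((hR t).1 ht).1, fun s F hs => ?_⟩
    have h1 : (sep (funs (omega M) (V θ)) fun t => ¬(merge F s t ε P ∧ merge F s t ε Q)) ε D :=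
      hD.nand (hP.2 s F hs) (hQ.2 s F hs) fun t => by
        rw [mem_sep, mem_funs]
        refine and_congr_right fun ht => ?_
        simp only [mem_subst, ht, true_and]
    refine hD.nand h1 h1 fun t => mem_subst.trans (and_congr_right fun ht => ?_)
    rw [hR, and_self, mem_sep, mem_funs]
    simp [ht]
  · rw [mem_substFamily] at hQ
    refine mem_substFamily.2 ⟨fun t ht => ((hR t).1 ht).1, fun s F hs => ?_⟩
    -- The bound variable `i` must stay a variable, so it joins the unsubstituted ones.
    let F' := sUn (upair F (upair i i))
    have hF' : ∀ j, j ε F' ↔ j ε F ∨ j = i := fun j => by simp [F']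
    -- The projection rule acts on the complement of an intersection, so it is applied to the
    -- complement of the relation to be projected.
    have h1 := hcompl (hQ.2 s F' hs)
    refine hD.proj _ h1 _ h1 i (isOrd_omega.mem hi) _ fun t =>
      mem_subst.trans (and_congr_right fun ht => ?_)
    have hm := isFun_merge (F := F) (hV hs) ht
    simp only [hR, hm, true_and, and_self]
    constructor
    · rintro ⟨u, hu, hmu⟩
      have huf := hQ.1 u hu
      rw [hm.1.agreeOff_iff huf.1] at hmu
      have ht' := ht.upd hi (huf.ap_mem hi)
      refine ⟨_, ht', ?_, ht.1.agreeOff_upd⟩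
      rw [mem_sep, mem_funs, mem_subst]
      simp only [ht', true_and, not_not]
      convert hu using 1
      refine (isFun_merge (hV hs) ht').1.ext huf.1 fun j hj => ?_
      rw [ap_merge hj]
      by_cases hji : j = i
      · subst hji
        rw [pick, if_pos ((hF' j).2 (.inr rfl)), upd_same hj]
      · rw [← hmu j hj hji, ap_merge hj, upd_other hj hji]
        have : j ε F' ↔ j ε F := by simp [hF', hji]
        rw [this]
    · rintro ⟨u, hu, h, htu⟩
      rw [mem_sep, mem_funs, mem_subst] at h
      simp only [hu, true_and, not_not] at h
      refine ⟨_, h, ?_⟩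
      rw [hm.1.agreeOff_iff (isFun_merge (hV hs) hu).1]
      intro j hj hji
      have : j ε F' ↔ j ε F := by simp [hF', hji]
      rw [ap_merge hj, ap_merge hj, this, (ht.1.agreeOff_iff hu.1).1 htu j hj hji]

/-- The relation `t 0 = x` over `V_θ`. -/
noncomputable def pointRel (θ x : M) : M := sep (funs (omega M) (V θ)) fun t => ap t (emp M) = x

instance (f g : (ℕ → M) → M) [DfnF C f] [DfnF C g] :
    DfnF C fun v => pointRel (f v) (g v) := by unfold pointRel; infer_instance

theorem mem_pointRel {θ x t : M} :
    t ε pointRel θ x ↔ IsFun t (omega M) (V θ) ∧ ap t (emp M) = x := by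
  rw [pointRel, mem_sep, mem_funs]

theorem pointRel_inj {θ x y : M} (hx : x ε V θ) (h : pointRel θ x = pointRel θ y) : x = y := by
  have h1 : (lam (omega M) fun _ => x) ε pointRel θ x :=
    mem_pointRel.2 ⟨isFun_lam fun _ _ => hx, ap_lam emp_mem_omega⟩
  have h2 := h1
  rw [h] at h2
  exact (mem_pointRel.1 h1).2.symm.trans (mem_pointRel.1 h2).2

/-- Once the ordinal parameters are substituted into the defining relation, what remains is the
relation `t 0 = x`, which occurs in the enumeration. Thus `(θ, α)` codes `x`. -/
theorem IsOD.exists_enum {x : M} (h : IsOD x) :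
    ∃ θ, IsOrd θ ∧ ∃ α, IsOrd α ∧ x ε V θ ∧ enum θ α = pointRel θ x := by
  obtain ⟨θ, A, ⟨hA, hx⟩, w, hw, z, hz, R, hR, s, hs, h⟩ := h
  obtain ⟨hθ, rfl⟩ := isV_iff.1 hA
  rw [isOmega_iff] at hw
  rw [isEmp_iff] at hz
  subst hw hz
  obtain ⟨δ, hδ, hD⟩ := exists_isRuleClosed θ
  obtain ⟨hRf, hRD⟩ := mem_substFamily.1 (hR _ (hD.isDefClosed_substFamily hθ))
  -- All coordinates take their value from `s`, except `0`, which stands for the element being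
  -- defined.
  obtain ⟨α, hα, e⟩ := mem_img.1 (hRD s (upair (emp M) (emp M)) hs)
  refine ⟨θ, hθ, α, hδ.mem hα, hx, e.symm.trans (eq_of_mem_iff fun t => ?_)⟩
  rw [mem_subst, mem_pointRel]
  refine and_congr_right fun ht => ?_
  have hsV : IsFun s (omega M) (V θ) :=
    isFun_iff.2 ⟨hs.1, fun i hi => subset_V hθ _ (hs.ap_mem hi)⟩
  have hm := isFun_merge (F := upair (emp M) (emp M)) hsV ht
  have h0 : ap (merge (upair (emp M) (emp M)) s t) (emp M) = ap t (emp M) := by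
    rw [ap_merge emp_mem_omega, pick, if_pos (by simp)]
  have h1 : ∀ j, j ε omega M → j ≠ emp M → ap (merge (upair (emp M) (emp M)) s t) j = ap s j :=
    fun j hj hj0 => by rw [ap_merge hj, pick, if_neg (by simpa using hj0)]
  constructor
  · intro hmR
    refine (h _ (ht.ap_mem emp_mem_omega)).1 ⟨_, hmR, ?_, ?_⟩
    · exact (hs.1.agreeOff_iff hm.1).2 fun j hj hj0 => (h1 j hj hj0).symm
    · exact hm.1.app_iff.2 ⟨emp_mem_omega, h0.symm⟩
  · intro htx
    obtain ⟨u, hu, hsu, hux⟩ := (h x hx).2 rfl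
    have huf := hRf u hu
    convert hu using 1
    refine hm.1.ext huf.1 fun j hj => ?_
    by_cases hj0 : j = emp M
    · subst hj0
      rw [h0, htx, (huf.1.app_iff.1 hux).2]
    · rw [h1 j hj hj0, (hs.1.agreeOff_iff huf.1).1 hsu j hj hj0]

theorem exists_dfnC_ord {P : M → Prop} [hP : Dfn ∅ fun v => P (v 0)]
    (h : ∃ α, IsOrd α ∧ P α) : ∃ α, DfnC ∅ α ∧ IsOrd α ∧ P α := by
  have hP' : Dfn Set.univ fun v => P (v 0) := hP.fix Sum.inr
  have := @Dfn.comp₁ _ _ _ _ _ P hP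
  obtain ⟨α, hα, hPα⟩ := h
  obtain ⟨h1, h2, -⟩ := isLeast_least hα hPα
  exact ⟨_, ⟨inferInstance⟩, h1, h2⟩

/-- A definable property of an ordinal definable element is a property of a definable element. -/
theorem exists_dfnC_of_isOD {P : M → Prop} [hP : Dfn ∅ fun v => P (v 0)]
    (h : ∃ x, IsOD x ∧ P x) : ∃ x, DfnC ∅ x ∧ P x := by
  have := @Dfn.comp₁ _ _ _ _ _ P hP
  obtain ⟨x, hx, hPx⟩ := h
  obtain ⟨θ, hθ, α, hα, hxθ, e⟩ := hx.exists_enum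
  -- Minimising `θ`, then `α` for this `θ`, gives definable codes. The set they code satisfies `P`
  -- but may differ from the original one.
  obtain ⟨θ, hθ', -, α, hα, h⟩ := exists_dfnC_ord (P := fun θ => ∃ α, IsOrd α ∧
    ∃ x, x ε V θ ∧ P x ∧ enum θ α = pointRel θ x) ⟨θ, hθ, α, hα, x, hxθ, hPx, e⟩
  obtain ⟨α, hα', -, x, hx, hPx, e⟩ := exists_dfnC_ord (P := fun α =>
    ∃ x, x ε V θ ∧ P x ∧ enum θ α = pointRel θ x) ⟨α, hα, h⟩
  refine ⟨x, DfnC.of_unique (fun x => x ε V θ ∧ P x ∧ enum θ α = pointRel θ x) fun y => ?_, hPx⟩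
  exact ⟨fun h => h ▸ ⟨hx, hPx, e⟩, fun h => pointRel_inj h.1 (h.2.2.symm.trans e)⟩

end Enumeration

/-! ### Algebraic elements, and the substructure of definable elements. -/

section PointwiseAlgebraic

universe w
variable {M : Type w} [LSet.Structure M]

theorem Dfn.of_formula (φ : LSet.Formula (Fin 1)) :
    Dfn (∅ : Set M) fun v => φ.Realize fun _ => v 0 := by
  have : ∀ i : Fin 1, DfnF (∅ : Set M) fun v => v 0 := fun _ => inferInstance
  exact (Dfn.realize (C := ∅) (BoundedFormula.relabel Sum.inr φ : SetFormula 1)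
    fun _ (v : ℕ → M) => v 0).congr fun v => Formula.realize_relabel_sumInr _

variable [Nonempty M] [hZF : M ⊨ ZF]

set_option linter.unusedSectionVars false

/-- The elements of a finite definable set of sets of ordinal definable elements are definable. -/
theorem dfnC_of_finite (n : ℕ) : ∀ (P : M → Prop) [Dfn ∅ fun v => P (v 0)],
    {x | P x}.Finite → {x | P x}.ncard = n → (∀ x, P x → ∀ y, y ε x → IsOD y) →
    ∀ a, P a → DfnC ∅ a := by
  induction n using Nat.strong_induction_on with
  | _ n ih =>
    intro P hP hfin hn hOD a ha
    by_cases hu : ∀ x, P x → x = a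
    · exact DfnC.of_unique P fun x => ⟨fun h => h ▸ ha, hu x⟩
    push Not at hu
    obtain ⟨b, hb, hba⟩ := hu
    have i1 := @Dfn.comp₁ _ _ _ _ _ P hP
    -- Some element separates `a` from `b`. Being ordinal definable, it can be traded for a
    -- definable element that separates two members of `P`, though perhaps not these two.
    have hx : ∃ x, IsOD x ∧ ((∃ b, P b ∧ x ε b) ∧ ∃ c, P c ∧ ¬x ε c) := by
      have : ∃ x, ¬(x ε b ↔ x ε a) := by
        by_contra! h
        exact hba (eq_of_mem_iff h)
      obtain ⟨x, hx⟩ := this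
      by_cases h : x ε b
      · exact ⟨x, hOD b hb x h, ⟨b, hb, h⟩, a, ha, by tauto⟩
      · exact ⟨x, hOD a ha x (by tauto), ⟨a, ha, by tauto⟩, b, hb, h⟩
    obtain ⟨x, hxd, ⟨b, hb, hxb⟩, c, hc, hxc⟩ :=
      exists_dfnC_of_isOD (P := fun x => (∃ b, P b ∧ x ε b) ∧ ∃ c, P c ∧ ¬x ε c) hx
    -- A definable property that holds at `a` and fails somewhere in `P` cuts out a smaller finite
    -- definable set containing `a`.
    have step : ∀ (Q : M → Prop) [Dfn ∅ fun v => Q (v 0)], Q a → (∃ d, P d ∧ ¬Q d) →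
        DfnC ∅ a := by
      rintro Q hQ hQa ⟨d, hd, hQd⟩
      have hss : {x | P x ∧ Q x} ⊂ {x | P x} :=
        ⟨fun x hx => hx.1, fun h => hQd (h hd).2⟩
      exact ih _ (hn ▸ Set.ncard_lt_ncard hss hfin) (fun x => P x ∧ Q x) (hfin.subset hss.1) rfl
        (fun y hy => hOD y hy.1) a ⟨ha, hQa⟩
    by_cases hxa : x ε a
    · exact step (fun y => x ε y) hxa ⟨c, hc, hxc⟩
    · exact step (fun y => ¬x ε y) hxa ⟨b, hb, not_not.2 hxb⟩

theorem isOD_of_isPointwiseAlgebraic (h : IsPointwiseAlgebraic LSet M) (a : M) : IsOD a := by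
  refine mem_induction (P := IsOD) (fun a ha => ?_) a
  obtain ⟨φ, hφ, hfin⟩ := h a
  have := Dfn.of_formula (M := M) φ
  -- Other solutions of `φ` might have elements that are not ordinal definable; the added conjunct
  -- discards them and keeps `a` by the induction hypothesis.
  refine isOD_of_dfnC (dfnC_of_finite _ (fun x => φ.Realize (fun _ => x) ∧ ∀ y, y ε x → IsOD y)
    (hfin.subset fun x hx => hx.1) rfl (fun x hx => hx.2) a ⟨hφ, ha⟩)

variable (M) in
/-- The substructure of the elements that are definable without parameters. -/
def definableElements : LSet.Substructure M where
  carrier := {a | DfnC ∅ a}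
  fun_mem F := Empty.elim F

/-- Tarski–Vaught: the parameters are definable, so the set of witnesses is definable without
parameters. Its members are ordinal definable, so it has a definable member. -/
theorem isElementary_definableElements (h : ∀ a : M, IsOD a) :
    (definableElements M).IsElementary := by
  refine Substructure.isElementary_of_exists _ fun n φ x a ha => ?_
  have : ∀ i, DfnF ∅ fun _ : ℕ → M => (x i : M) := fun i =>
    (show DfnC ∅ (x i : M) from (x i).2).out
  have : Dfn ∅ fun v : ℕ → M => φ.Realize default
    (Fin.snoc (α := fun _ => M) (fun i => (x i : M)) (v 0)) := inferInstance
  obtain ⟨b, hb, hφ⟩ := exists_dfnC_of_isOD (P := fun y => φ.Realize default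
    (Fin.snoc (α := fun _ => M) (fun i => (x i : M)) y)) ⟨a, h a, ha⟩
  exact ⟨⟨b, hb⟩, hφ⟩

/-- By elementarity, the formula that defines `a` in `M` also defines it in the substructure. -/
theorem isPointwiseAlgebraic_definableElements (h : (definableElements M).IsElementary) :
    IsPointwiseAlgebraic LSet (definableElements M) := by
  intro a
  have ha : DfnC ∅ (a : M) := a.2
  obtain ⟨φ, hφ⟩ := Dfn.exists_formula (P := fun x => x = (a : M)) inferInstance
  have key : ∀ b : definableElements M, φ.Realize (fun _ => b) ↔ b = a := fun b => by
    rw [← h φ fun _ => b, Subtype.ext_iff, ← hφ]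
    rfl
  exact ⟨φ, (key a).2 rfl, (Set.finite_singleton a).subset fun b hb => (key b).1 hb⟩

theorem IsPointwiseAlgebraic.of_equiv {L : FirstOrder.Language} {M N : Type*} [L.Structure M]
    [L.Structure N] (e : M ≃[L] N) (h : IsPointwiseAlgebraic L M) : IsPointwiseAlgebraic L N := by
  intro a
  obtain ⟨φ, hφ, hfin⟩ := h (e.symm a)
  have key : ∀ x : N, φ.Realize (fun _ => e.symm x) ↔ φ.Realize fun _ => x := fun x =>
    StrongHomClass.realize_formula e.symm φ (v := fun _ => x)
  refine ⟨φ, (key a).1 hφ, ?_⟩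
  refine (hfin.image e).subset fun x hx => ⟨e.symm x, (key x).2 hx, e.apply_symm_apply x⟩

end PointwiseAlgebraic

end SetTheoryLogic

theorem corollary3 (T : SetTheoryLogic.LSet.Theory)
    (hT : SetTheoryLogic.Extends T SetTheoryLogic.ZF) :
    (∃ M : FirstOrder.Language.Theory.ModelType.{0, 0, u} T,
        SetTheoryLogic.IsPointwiseAlgebraic SetTheoryLogic.LSet M) ↔
      SetTheoryLogic.IsConsistentWith T SetTheoryLogic.VeqHOD := by
  open FirstOrder FirstOrder.Language SetTheoryLogic in
  constructor
  · rintro ⟨M, hM⟩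
    have : M ⊨ ZF := ⟨fun σ hσ => (hT σ hσ).realize_sentence M⟩
    have : M ⊨ T ∪ {VeqHOD} := by
      refine (Theory.model_union_iff).2 ⟨inferInstance, Theory.model_singleton_iff.2 ?_⟩
      exact realize_VeqHOD.2 (isOD_of_isPointwiseAlgebraic hM)
    exact Theory.Model.isSatisfiable M
  · rintro ⟨M⟩
    obtain ⟨hMT, hM⟩ := (Theory.model_union_iff (M := M) (T := T) (T' := {VeqHOD})).1 M.is_model
    have : M ⊨ ZF := ⟨fun σ hσ => (hT σ hσ).realize_sentence M⟩
    have hel := isElementary_definableElements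
      (realize_VeqHOD.1 (Theory.model_singleton_iff.1 hM))
    let S : LSet.ElementarySubstructure M := ⟨definableElements M, hel⟩
    have : S ⊨ T := inferInstance
    let N : Theory.ModelType.{0, 0, 0} T := Theory.ModelType.of T S
    -- Satisfiability provides a model in universe `0`, which is lifted to universe `u`.
    exact ⟨N.ulift, IsPointwiseAlgebraic.of_equiv
      (Equiv.inducedStructureEquiv (L := LSet) (Equiv.ulift.{u, 0}.symm : N ≃ ULift N))
      (isPointwiseAlgebraic_definableElements hel)⟩
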